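/- Let $K$ be a commutative ring, $\mathsf{A}$ a $K$-linear abelian category, and $(\mathcal{T},\mathcal{F})$ a torsion theory in $\mathsf{A}$ (full subcategories, closed under isomorphism, with $\operatorname{Hom}(T,F)=0$ for $T\in\mathcal{T}$, $F\in\mathcal{F}$, such that every object is an extension of an object of $\mathcal{F}$ by an object of $\mathcal{T}$). **The tilt $\mathsf{B}$.** Its objects are the morphisms $\mathbb{X}=[X^{-1}\xrightarrow{d_X}X^0]$ in $\mathsf{A}$ with $\ker d_X\in\mathcal{F}$ and $\operatorname{coker}d_X\in\mathcal{T}$. A morphism $\mathbb{X}\to\mathbb{Y}$ is an isomorphism class of butterflies: an object $E$ with maps $\kappa:X^{-1}\to E$, $\iota:Y^{-1}\to E$, $\sigma:E\to X^0$, $\rho:E\to Y^0$ such that $\sigma\kappa=d_X$, $\rho\iota=d_Y$, $\rho\kappa=0$ and $0\to Y^{-1}\xrightarrow{\iota}E\xrightarrow{\sigma}X^0\to0$ is exact. The composite of $E$ and $F$ has middle term the quotient of $E\times_{Y^0}F$ by $Y^{-1}$ (embedded by $\iota_E$ and $\kappa_F$); addition is the Baer sum. A morphism of two-term complexes $(f^{-1},f^0):\mathbb{X}\to\mathbb{Y}$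 gives the butterfly with $E=X^0\oplus Y^{-1}$, $\kappa=(d_X,-f^{-1})$, $\iota$ the inclusion, $\sigma$ the projection, $\rho=(f^0,d_Y)$; the morphisms of $\mathsf{B}$ arising in this way are called strict. $\mathsf{B}$ is a $K$-linear category. **The DG category $\mathfrak{Ch}(\mathsf{A},\mathcal{T},\mathcal{F})$.** Its objects are the (unbounded) cochain complexes $E^\bullet$ in $\mathsf{A}$ with subobjects $M^n\subseteq E^n$ (not necessarily preserved by the differential $\delta_E$) such that for every $n$ the induced map $M^n\to E^{n+1}/M^{n+1}$ has kernel in $\mathcal{F}$ and cokernel in $\mathcal{T}$. For two such objects let $\mathfrak{hom}^k$ be the module of families $\gamma=(g_n:E^n\to F^{n+k})_{n\in\mathbb{Z}}$ such that $g_n(M^n)\subseteq N^{n+k}$ and $(d\gamma)_n:=\delta_Fg_n-(-1)^kg_{n+1}\delta_E$ maps $M^n$ into $N^{n+k+1}$ for all $n$; let $\mathcal{M}^k\subseteq\mathfrak{hom}^k$ be the submodule of families with $g_n(M^n)=0$ and $g_n(E^n)\subseteq N^{n+k}$ for all $n$. The Hom complex of $\mathfrak{Ch}(\mathsf{A},\mathcal{T},\mathcal{F})$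 is $\mathcal{H}^0(\mathfrak{hom},\mathcal{M})[-1]$, whose degree $k$ term is $\mathfrak{hom}^k/(\mathcal{M}^k+d\mathcal{M}^{k-1})$, with the differential and the composition induced by $d$ and by the composition of families. Let $\mathsf{Ch}(\mathsf{A},\mathcal{T},\mathcal{F})$ be the ordinary category with the same objects, whose morphisms are the chain maps $f$ with $f(M^n)\subseteq N^n$. **The DG category $\mathfrak{Ch}^{st}(\mathsf{B})$.** Its objects are the (unbounded) cochain complexes $\mathbf{X}=({}^n\mathbb{X})_n$ in $\mathsf{B}$. It is the DG subcategory of the usual DG category of complexes in $\mathsf{B}$ whose morphisms of degree $k$ from $\mathbf{X}$ to $\mathbf{Y}$ are the families of strict morphisms $h_n=(h_n^{-1},h_n^0):{}^n\mathbb{X}\to{}^{n+k}\mathbb{Y}$ such that for every $n$ there is a map $E^n\to F^{n+k}$ that restricts to $(-1)^kh_n^{-1}$ on ${}^nX^{-1}\to{}^{n+k}Y^{-1}$ and induces $h_{n-1}^0:{}^{n-1}X^0\to{}^{n+k-1}Y^0$ on the quotients, where $E^n$ and $F^{m}$ are the middle terms of butterflies representing the differentials ${}^{n-1}\mathbb{X}\to{}^n\mathbb{X}$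 and ${}^{m-1}\mathbb{Y}\to{}^{m}\mathbb{Y}$. Let $\mathsf{Ch}^{st}(\mathsf{B})$ be the ordinary category with the same objects, whose morphisms are the chain maps with strict components. **The functor $G$.** $G:\mathsf{Ch}(\mathsf{A},\mathcal{T},\mathcal{F})\to\mathsf{Ch}^{st}(\mathsf{B})$ sends $(E^\bullet,M^\bullet)$ to the complex with $n$-th term $[M^n\to E^{n+1}/M^{n+1}]$, whose differential from the $n$-th to the $(n+1)$-st term is the butterfly with middle term $E^{n+1}$ and the maps induced by $\delta_E$, the inclusion of $M^{n+1}$ and the projections; it sends $f$ to the strict morphisms induced by $f^n$ and $f^{n+1}$. **Proposition.** The functor $G$ enriches to a $K$-linear DG functor $\mathfrak{G}:\mathfrak{Ch}(\mathsf{A},\mathcal{T},\mathcal{F})\to\mathfrak{Ch}^{st}(\mathsf{B})$: it has the action of $G$ on objects, it sends the class of a family $\gamma=(g_n)$ of degree $k$ to the family of strict morphisms $\mathfrak{G}(\gamma)_n=\big((-1)^k\,g_n|_{M^n},\ \bar g_{n+1}\big)$, where $\bar g_{n+1}:E^{n+1}/M^{n+1}\to F^{n+k+1}/N^{n+k+1}$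 is induced by $g_{n+1}$, and it agrees with $G$ on (classes of) chain maps. This DG functor is a DG equivalence in the strong sense: it induces isomorphisms $$\mathcal{H}^0(\mathfrak{hom},\mathcal{M})[-1]\ \xrightarrow{\ \sim\ }\ \mathfrak{Hom}_{\mathfrak{Ch}^{st}(\mathsf{B})}\big(G(E^\bullet,M^\bullet),G(F^\bullet,N^\bullet)\big)$$ of complexes of $K$-modules for all pairs of objects, and every object of $\mathfrak{Ch}^{st}(\mathsf{B})$ is isomorphic, by closed morphisms of degree $0$, to an object in the image of $G$. -/

import Mathlib

open CategoryTheory CategoryTheory.Limits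

namespace HRS

universe w v u

section Basic

/-- A torsion theory in an abelian category: full replete subcategories `T` and `F` such that there
are no nonzero morphisms from `T` to `F`, and every object is an extension of an object of `F` by an
object of `T`. -/
structure TorsionTheory (A : Type u) [Category.{v} A] [Abelian A] where
  T : ObjectProperty A
  F : ObjectProperty A
  T_iso : T.IsClosedUnderIsomorphisms
  F_iso : F.IsClosedUnderIsomorphisms
  hom_eq_zero : ∀ {X Y : A}, T X → F Y → ∀ f : X ⟶ Y, f = 0
  exists_shortExact : ∀ X : A, ∃ (X' X'' : A) (i : X' ⟶ X) (p : X ⟶ X'') (w : i ≫ p = 0),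
    T X' ∧ F X'' ∧ (ShortComplex.mk i p w).ShortExact

/-- The objects of the tilted category `B`: complexes `[X⁻¹ ⟶ X⁰]` with kernel in `F` and cokernel
in `T`. -/
structure Tilt {A : Type u} [Category.{v} A] [Abelian A] (τ : TorsionTheory A) where
  neg : A
  zer : A
  d : neg ⟶ zer
  ker_mem : τ.F (kernel d)
  coker_mem : τ.T (cokernel d)

variable {A : Type u} [Category.{v} A] [Abelian A] {τ : TorsionTheory A}

/-- A butterfly from `[X⁻¹ ⟶ X⁰]` to `[Y⁻¹ ⟶ Y⁰]`: a commutative diagram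
```
  X⁻¹         Y⁻¹
   |  κ     ι  |
   |    ↘ ↙    |
   |     E     |
   |    ↙ ↘    |
   v  σ     ρ  v
  X⁰          Y⁰
```
where `κ ≫ ρ = 0` and `0 ⟶ Y⁻¹ ⟶ E ⟶ X⁰ ⟶ 0` is a short exact sequence. -/
structure Butterfly (X Y : Tilt τ) where
  E : A
  κ : X.neg ⟶ E
  ι : Y.neg ⟶ E
  σ : E ⟶ X.zer
  ρ : E ⟶ Y.zer
  κ_σ : κ ≫ σ = X.d
  ι_ρ : ι ≫ ρ = Y.d
  κ_ρ : κ ≫ ρ = 0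
  ι_σ : ι ≫ σ = 0
  shortExact : (ShortComplex.mk ι σ ι_σ).ShortExact

attribute [simp] Butterfly.κ_σ Butterfly.ι_ρ Butterfly.κ_ρ Butterfly.ι_σ

attribute [local simp] pullback.lift_fst pullback.lift_snd pullback.lift_fst_assoc
  pullback.lift_snd_assoc

namespace Butterfly

section
variable {X Y : Tilt τ} (P : Butterfly X Y)

@[simp] lemma κ_σ_assoc {W : A} (h : X.zer ⟶ W) : P.κ ≫ P.σ ≫ h = X.d ≫ h := by
  rw [← Category.assoc, κ_σ]
@[simp] lemma ι_ρ_assoc {W : A} (h : Y.zer ⟶ W) : P.ι ≫ P.ρ ≫ h = Y.d ≫ h := by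
  rw [← Category.assoc, ι_ρ]
@[simp] lemma κ_ρ_assoc {W : A} (h : Y.zer ⟶ W) : P.κ ≫ P.ρ ≫ h = 0 := by
  rw [← Category.assoc, κ_ρ, zero_comp]
@[simp] lemma ι_σ_assoc {W : A} (h : X.zer ⟶ W) : P.ι ≫ P.σ ≫ h = 0 := by
  rw [← Category.assoc, ι_σ, zero_comp]

instance : Mono P.ι := P.shortExact.mono_f
instance : Epi P.σ := P.shortExact.epi_g

lemma lift_ι {W : A} (x : W ⟶ P.E) (h : x ≫ P.σ = 0) : ∃ y : W ⟶ Y.neg, y ≫ P.ι = x :=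
  ⟨P.shortExact.exact.lift x h, P.shortExact.exact.lift_f x h⟩

end

/-- Isomorphism of butterflies. -/
def Rel {X Y : Tilt τ} (P Q : Butterfly X Y) : Prop :=
  ∃ e : P.E ≅ Q.E, P.κ ≫ e.hom = Q.κ ∧ P.ι ≫ e.hom = Q.ι ∧
    e.hom ≫ Q.σ = P.σ ∧ e.hom ≫ Q.ρ = P.ρ

lemma rel_of_hom {X Y : Tilt τ} {P Q : Butterfly X Y} (g : P.E ⟶ Q.E) (h1 : P.κ ≫ g = Q.κ)
    (h2 : P.ι ≫ g = Q.ι) (h3 : g ≫ Q.σ = P.σ) (h4 : g ≫ Q.ρ = P.ρ) : Rel P Q := by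
  let φ : ShortComplex.mk P.ι P.σ P.ι_σ ⟶ ShortComplex.mk Q.ι Q.σ Q.ι_σ :=
    { τ₁ := 𝟙 _, τ₂ := g, τ₃ := 𝟙 _, comm₁₂ := by simp [h2], comm₂₃ := by simp [h3] }
  have : IsIso φ.τ₁ := by dsimp [φ]; infer_instance
  have : IsIso φ.τ₃ := by dsimp [φ]; infer_instance
  have : IsIso φ.τ₂ := ShortComplex.isIso₂_of_shortExact_of_isIso₁₃ φ P.shortExact Q.shortExact
  have : IsIso g := this
  exact ⟨asIso g, h1, h2, h3, h4⟩

lemma Rel.refl {X Y : Tilt τ} (P : Butterfly X Y) : Rel P P :=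
  ⟨Iso.refl _, by simp, by simp, by simp, by simp⟩

lemma Rel.symm {X Y : Tilt τ} {P Q : Butterfly X Y} : Rel P Q → Rel Q P := by
  rintro ⟨e, h1, h2, h3, h4⟩
  exact ⟨e.symm, by simp [← h1], by simp [← h2], by simp [← h3], by simp [← h4]⟩

lemma Rel.trans {X Y : Tilt τ} {P Q R : Butterfly X Y} : Rel P Q → Rel Q R → Rel P R := by
  rintro ⟨e, h1, h2, h3, h4⟩ ⟨e', h1', h2', h3', h4'⟩
  exact ⟨e ≪≫ e', by simp [reassoc_of% h1, h1'], by simp [reassoc_of% h2, h2'],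
    by simp [h3, h3'], by simp [h4, h4']⟩

/-- Being isomorphic is an equivalence relation on butterflies. -/
instance setoid (X Y : Tilt τ) : Setoid (Butterfly X Y) :=
  ⟨Rel, Rel.refl, Rel.symm, Rel.trans⟩

/-- Two butterflies are isomorphic if they are dominated by a common object. -/
lemma rel_of_span {X Y : Tilt τ} {P Q : Butterfly X Y} {S : A} (a : S ⟶ P.E) [Epi a]
    (b : S ⟶ Q.E) (hk : ∀ {W : A} (x : W ⟶ S), x ≫ a = 0 → x ≫ b = 0)
    (k : X.neg ⟶ S) (hka : k ≫ a = P.κ) (hkb : k ≫ b = Q.κ)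
    (i : Y.neg ⟶ S) (hia : i ≫ a = P.ι) (hib : i ≫ b = Q.ι)
    (hσ : b ≫ Q.σ = a ≫ P.σ) (hρ : b ≫ Q.ρ = a ≫ P.ρ) : Rel P Q := by
  have hg : a ≫ Abelian.epiDesc a b (hk _ (kernel.condition a)) = b := Abelian.comp_epiDesc _ _ _
  refine rel_of_hom (Abelian.epiDesc a b (hk _ (kernel.condition a))) ?_ ?_ ?_ ?_
  · rw [← hka, Category.assoc, hg, hkb]
  · rw [← hia, Category.assoc, hg, hib]
  · rw [← cancel_epi a, reassoc_of% hg, hσ]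
  · rw [← cancel_epi a, reassoc_of% hg, hρ]

/-! ### composition -/

section
variable {X Y Z : Tilt τ} (P : Butterfly X Y) (Q : Butterfly Y Z)

/-- The map `(ι, κ') : Y⁻¹ ⟶ E ×_{Y⁰} F`. -/
noncomputable def compJ : Y.neg ⟶ pullback P.ρ Q.σ := pullback.lift P.ι Q.κ (by simp)

@[simp] lemma compJ_fst : compJ P Q ≫ pullback.fst _ _ = P.ι := by simp [compJ]
@[simp] lemma compJ_snd : compJ P Q ≫ pullback.snd _ _ = Q.κ := by simp [compJ]
@[simp] lemma compJ_fst_assoc {W : A} (h : P.E ⟶ W) :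
    compJ P Q ≫ pullback.fst _ _ ≫ h = P.ι ≫ h := by rw [← Category.assoc, compJ_fst]
@[simp] lemma compJ_snd_assoc {W : A} (h : Q.E ⟶ W) :
    compJ P Q ≫ pullback.snd _ _ ≫ h = Q.κ ≫ h := by rw [← Category.assoc, compJ_snd]

instance : Mono (compJ P Q) := by
  have : Mono (compJ P Q ≫ pullback.fst _ _) := by rw [compJ_fst]; infer_instance
  exact mono_of_mono _ (pullback.fst _ _)

lemma exists_of_cokernel_π {V L W : A} (j : V ⟶ L) [Mono j] (x : W ⟶ L)
    (h : x ≫ cokernel.π j = 0) : ∃ y, y ≫ j = x :=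
  ⟨(ShortComplex.exact_cokernel j).lift x h, (ShortComplex.exact_cokernel j).lift_f x h⟩

/-- The composition of butterflies: the cokernel of `Y⁻¹ ⟶ E ×_{Y⁰} F` with the evident maps. -/
noncomputable def comp : Butterfly X Z where
  E := cokernel (compJ P Q)
  κ := pullback.lift P.κ 0 (by simp) ≫ cokernel.π _
  ι := pullback.lift 0 Q.ι (by simp) ≫ cokernel.π _
  σ := cokernel.desc _ (pullback.fst _ _ ≫ P.σ) (by simp)
  ρ := cokernel.desc _ (pullback.snd _ _ ≫ Q.ρ) (by simp)
  κ_σ := by simp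
  ι_ρ := by simp
  κ_ρ := by simp
  ι_σ := by simp
  shortExact := by
    have h1 : Mono (pullback.lift (f := P.ρ) (g := Q.σ) 0 Q.ι (by simp) ≫
        cokernel.π (compJ P Q)) := by
      refine Preadditive.mono_of_cancel_zero _ fun {W} x hx => ?_
      obtain ⟨y, hy⟩ := exists_of_cokernel_π _ (x ≫ pullback.lift (f := P.ρ) (g := Q.σ) 0 Q.ι
        (by simp)) (by simpa using hx)
      have h1 := hy =≫ pullback.fst _ _
      have h2 := hy =≫ pullback.snd _ _
      simp only [Category.assoc, compJ_fst, compJ_snd, pullback.lift_fst, pullback.lift_snd,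
        comp_zero] at h1 h2
      have hy0 : y = 0 := by rw [← cancel_mono P.ι, h1, zero_comp]
      rw [← cancel_mono Q.ι, ← h2, hy0, zero_comp, zero_comp]
    have h2 : Epi (cokernel.desc (compJ P Q) (pullback.fst _ _ ≫ P.σ)
        (by simp)) := by
      have : Epi (cokernel.π (compJ P Q) ≫ cokernel.desc (compJ P Q) (pullback.fst _ _ ≫ P.σ)
        (by simp)) := by
        rw [cokernel.π_desc]; infer_instance
      exact epi_of_epi (cokernel.π (compJ P Q)) _
    refine ShortComplex.ShortExact.mk' ?_ h1 h2
    rw [ShortComplex.exact_iff_exact_up_to_refinements]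
    intro W x hx
    dsimp at x hx
    obtain ⟨W', p, hp, l, hl⟩ := surjective_up_to_refinements_of_epi (cokernel.π _) x
    have hx' : (l ≫ pullback.fst _ _) ≫ P.σ = 0 := by
      have := p ≫= hx
      simpa [reassoc_of% hl] using this
    obtain ⟨y, hy⟩ := P.lift_ι (l ≫ pullback.fst _ _) hx'
    obtain ⟨z, hz⟩ := Q.lift_ι (l ≫ pullback.snd _ _ - y ≫ Q.κ) (by
      rw [Preadditive.sub_comp, Category.assoc, ← pullback.condition, ← Category.assoc, ← hy]
      simp)
    refine ⟨W', p, hp, z, ?_⟩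
    have : l = y ≫ compJ P Q + z ≫ pullback.lift 0 Q.ι (by simp) := by
      apply pullback.hom_ext
      · simp [hy]
      · simp [hz]
    dsimp
    rw [hl, this]
    simp

/-- The quotient map onto the middle object of the composition. -/
noncomputable def compπ : pullback P.ρ Q.σ ⟶ (comp P Q).E := cokernel.π (compJ P Q)

instance : Epi (compπ P Q) := inferInstanceAs (Epi (cokernel.π _))

@[simp] lemma compJ_π : compJ P Q ≫ compπ P Q = 0 := cokernel.condition _

lemma comp_κ_def : pullback.lift P.κ 0 (by simp) ≫ compπ P Q = (comp P Q).κ := rfl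
lemma comp_ι_def : pullback.lift 0 Q.ι (by simp) ≫ compπ P Q = (comp P Q).ι := rfl

@[simp] lemma compπ_σ : compπ P Q ≫ (comp P Q).σ = pullback.fst _ _ ≫ P.σ := by
  simp [compπ, comp]
@[simp] lemma compπ_ρ : compπ P Q ≫ (comp P Q).ρ = pullback.snd _ _ ≫ Q.ρ := by
  simp [compπ, comp]

lemma comp_eq_of {W : A} (l l' : W ⟶ pullback P.ρ Q.σ) (y : W ⟶ Y.neg)
    (h1 : l ≫ pullback.fst _ _ = l' ≫ pullback.fst _ _ + y ≫ P.ι)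
    (h2 : l ≫ pullback.snd _ _ = l' ≫ pullback.snd _ _ + y ≫ Q.κ) :
    l ≫ compπ P Q = l' ≫ compπ P Q := by
  have : l = l' + y ≫ compJ P Q := by
    apply pullback.hom_ext <;> simp [h1, h2]
  rw [this]; simp

lemma comp_κ_eq {S : A} (k : S ⟶ pullback P.ρ Q.σ) (y : S ⟶ X.neg)
    (h1 : k ≫ pullback.fst _ _ = y ≫ P.κ) (h2 : k ≫ pullback.snd _ _ = 0) :
    k ≫ compπ P Q = y ≫ (comp P Q).κ := by
  have : k = y ≫ pullback.lift P.κ 0 (by simp) := by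
    apply pullback.hom_ext <;> simp [h1, h2]
  rw [this, Category.assoc, comp_κ_def]

lemma comp_ι_eq {S : A} (k : S ⟶ pullback P.ρ Q.σ) (y : S ⟶ Z.neg)
    (h1 : k ≫ pullback.fst _ _ = 0) (h2 : k ≫ pullback.snd _ _ = y ≫ Q.ι) :
    k ≫ compπ P Q = y ≫ (comp P Q).ι := by
  have : k = y ≫ pullback.lift 0 Q.ι (by simp) := by
    apply pullback.hom_ext <;> simp [h1, h2]
  rw [this, Category.assoc, comp_ι_def]

lemma comp_ker {W : A} (x : W ⟶ pullback P.ρ Q.σ) (h : x ≫ compπ P Q = 0) :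
    ∃ y : W ⟶ Y.neg, x ≫ pullback.fst _ _ = y ≫ P.ι ∧ x ≫ pullback.snd _ _ = y ≫ Q.κ := by
  obtain ⟨y, rfl⟩ := exists_of_cokernel_π _ x h
  exact ⟨y, by simp, by simp⟩

lemma comp_rel (R : Butterfly X Z) (φ : pullback P.ρ Q.σ ⟶ R.E)
    (hj : compJ P Q ≫ φ = 0)
    (hκ : pullback.lift P.κ 0 (by simp) ≫ φ = R.κ)
    (hι : pullback.lift 0 Q.ι (by simp) ≫ φ = R.ι)
    (hσ : φ ≫ R.σ = pullback.fst _ _ ≫ P.σ) (hρ : φ ≫ R.ρ = pullback.snd _ _ ≫ Q.ρ) :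
    Rel (comp P Q) R := by
  refine rel_of_span (compπ P Q) φ ?_ _ rfl hκ _ rfl hι (by simp [hσ]) (by simp [hρ])
  intro W x hx
  obtain ⟨y, rfl⟩ := exists_of_cokernel_π _ x hx
  simp [hj]

lemma comp_congr {P P' : Butterfly X Y} {Q Q' : Butterfly Y Z} (h : Rel P P') (h' : Rel Q Q') :
    Rel (comp P Q) (comp P' Q') := by
  obtain ⟨e, h1, h2, h3, h4⟩ := h
  obtain ⟨e', h1', h2', h3', h4'⟩ := h'
  have hm : (pullback.fst P.ρ Q.σ ≫ e.hom) ≫ P'.ρ = (pullback.snd P.ρ Q.σ ≫ e'.hom) ≫ Q'.σ := by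
    simp [h4, h3', pullback.condition]
  refine comp_rel _ _ _ (pullback.lift _ _ hm ≫ compπ P' Q') ?_ ?_ ?_ ?_ ?_
  · have := comp_eq_of P' Q' (compJ P Q ≫ pullback.lift _ _ hm) 0 (𝟙 _)
      (by simp [h2]) (by simp [h1'])
    simpa only [Category.assoc, zero_comp] using this
  · rw [← Category.assoc, comp_κ_eq P' Q' _ (𝟙 _) (by simp [h1]) (by simp), Category.id_comp]
  · rw [← Category.assoc, comp_ι_eq P' Q' _ (𝟙 _) (by simp) (by simp [h2']), Category.id_comp]
  · simp [h3]
  · simp [h4']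

end

/-- Associativity of the composition. -/
lemma comp_assoc_rel {X Y Z W : Tilt τ} (P : Butterfly X Y) (Q : Butterfly Y Z)
    (R : Butterfly Z W) : Rel (comp P (comp Q R)) (comp (comp P Q) R) := by
  let L := pullback P.ρ (comp Q R).σ
  let S := pullback (pullback.snd P.ρ (comp Q R).σ) (compπ Q R)
  let s1 : S ⟶ L := pullback.fst _ _
  let s2 : S ⟶ pullback Q.ρ R.σ := pullback.snd _ _
  let e : S ⟶ P.E := s1 ≫ pullback.fst _ _
  let f : S ⟶ Q.E := s2 ≫ pullback.fst _ _
  let g : S ⟶ R.E := s2 ≫ pullback.snd _ _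
  have hs : s1 ≫ pullback.snd _ _ = s2 ≫ compπ Q R := pullback.condition
  have hef : e ≫ P.ρ = f ≫ Q.σ := by
    have : s2 ≫ compπ Q R ≫ (comp Q R).σ = f ≫ Q.σ := by simp [f]
    rw [← this, ← reassoc_of% hs, ← pullback.condition]
    simp [e]
  have hfg : f ≫ Q.ρ = g ≫ R.σ := by simp [f, g, pullback.condition]
  let ef : S ⟶ (comp P Q).E := pullback.lift e f hef ≫ compπ P Q
  have hefg : ef ≫ (comp P Q).ρ = g ≫ R.σ := by simp [ef, hfg]
  have : Epi s1 := inferInstanceAs (Epi (pullback.fst _ _))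
  refine rel_of_span (s1 ≫ compπ P (comp Q R)) (pullback.lift ef g hefg ≫ compπ (comp P Q) R) ?_
    (pullback.lift (pullback.lift P.κ 0 (by simp)) 0 (by simp)) ?_ ?_
    (pullback.lift (pullback.lift 0 (comp Q R).ι (by simp)) (pullback.lift 0 R.ι (by simp))
      ?_) ?_ ?_ ?_ ?_
  · intro V x hx
    obtain ⟨y, hy1, hy2⟩ := comp_ker _ _ (x ≫ s1) (by simpa using hx)
    have h : (x ≫ s2 - y ≫ pullback.lift Q.κ 0 (by simp)) ≫ compπ Q R = 0 := by
      rw [Preadditive.sub_comp, Category.assoc, ← hs, ← Category.assoc, hy2,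
        Category.assoc, comp_κ_eq Q R _ (𝟙 _) (by simp) (by simp)]
      simp
    obtain ⟨z, hz1, hz2⟩ := comp_ker _ _ _ h
    have he : x ≫ e = y ≫ P.ι := by simpa [e] using hy1
    have hf : x ≫ f = y ≫ Q.κ + z ≫ Q.ι := by
      simp [sub_eq_iff_eq_add] at hz1
      simp [f, hz1, add_comm]
    have hg : x ≫ g = z ≫ R.κ := by
      simpa using hz2
    have key : x ≫ ef = z ≫ (comp P Q).ι := by
      rw [← comp_ι_eq P Q (z ≫ pullback.lift 0 Q.ι (by simp)) z (by simp) (by simp)]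
      simp only [ef, ← Category.assoc]
      exact comp_eq_of P Q _ _ y (by simp [he]) (by simp [hf, add_comm])
    have := comp_eq_of (comp P Q) R (x ≫ pullback.lift ef g hefg) 0 z (by simp [key])
      (by simp [hg])
    simpa using this
  · simp only [s1, ← Category.assoc, pullback.lift_fst]
    rw [comp_κ_eq _ _ _ (𝟙 _) (by simp) (by simp), Category.id_comp]
  · rw [← Category.assoc, comp_κ_eq _ _ _ (𝟙 _), Category.id_comp]
    · simp only [Category.assoc, pullback.lift_fst, Category.id_comp, ef]
      rw [← Category.assoc, comp_κ_eq _ _ _ (𝟙 _), Category.id_comp]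
      · simp [e, s1]
      · simp [f, s2]
    · simp [g, s2]
  · simp only [pullback.lift_snd]
    rw [comp_ι_eq _ _ _ (𝟙 _) (by simp) (by simp), Category.id_comp]
  · simp only [s1, ← Category.assoc, pullback.lift_fst]
    rw [comp_ι_eq _ _ _ (𝟙 _) (by simp) (by simp), Category.id_comp]
  · rw [← Category.assoc, comp_ι_eq _ _ _ (𝟙 _), Category.id_comp]
    · simp only [Category.assoc, pullback.lift_fst, ef]
      have := comp_eq_of P Q (pullback.lift (pullback.lift 0 (comp Q R).ι (by simp))
        (pullback.lift 0 R.ι (by simp)) (by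
          rw [pullback.lift_snd, comp_ι_eq Q R _ (𝟙 _) (by simp) (by simp), Category.id_comp])
          ≫ pullback.lift e f hef) 0 0 (by simp [e, s1]) (by simp [f, s2])
      simpa using this
    · simp [g, s2]
  · simp [ef, e]
  · simp [g, reassoc_of% hs]

/-! ### addition -/

section
variable {X Y : Tilt τ} (P Q : Butterfly X Y)

/-- The antidiagonal map `(ι, -ι') : Y⁻¹ ⟶ E ×_{X⁰} E'`. -/
noncomputable def addJ : Y.neg ⟶ pullback P.σ Q.σ := pullback.lift P.ι (-Q.ι) (by simp)

@[simp] lemma addJ_fst : addJ P Q ≫ pullback.fst _ _ = P.ι := by simp [addJ]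
@[simp] lemma addJ_snd : addJ P Q ≫ pullback.snd _ _ = -Q.ι := by simp [addJ]
@[simp] lemma addJ_fst_assoc {W : A} (h : P.E ⟶ W) :
    addJ P Q ≫ pullback.fst _ _ ≫ h = P.ι ≫ h := by rw [← Category.assoc, addJ_fst]
@[simp] lemma addJ_snd_assoc {W : A} (h : Q.E ⟶ W) :
    addJ P Q ≫ pullback.snd _ _ ≫ h = -Q.ι ≫ h := by
  rw [← Category.assoc, addJ_snd, Preadditive.neg_comp]

instance : Mono (addJ P Q) := by
  have : Mono (addJ P Q ≫ pullback.fst _ _) := by rw [addJ_fst]; infer_instance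
  exact mono_of_mono _ (pullback.fst _ _)

/-- The sum of two butterflies: the Baer sum of the extensions, with the induced maps from `X⁻¹`
and to `Y⁰`. -/
noncomputable def add : Butterfly X Y where
  E := cokernel (addJ P Q)
  κ := pullback.lift P.κ Q.κ (by simp) ≫ cokernel.π _
  ι := pullback.lift 0 Q.ι (by simp) ≫ cokernel.π _
  σ := cokernel.desc _ (pullback.fst _ _ ≫ P.σ) (by simp)
  ρ := cokernel.desc _ (pullback.fst _ _ ≫ P.ρ + pullback.snd _ _ ≫ Q.ρ) (by simp)
  κ_σ := by simp
  ι_ρ := by simp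
  κ_ρ := by simp
  ι_σ := by simp
  shortExact := by
    have h1 : Mono (pullback.lift (f := P.σ) (g := Q.σ) 0 Q.ι (by simp) ≫
        cokernel.π (addJ P Q)) := by
      refine Preadditive.mono_of_cancel_zero _ fun {W} x hx => ?_
      obtain ⟨y, hy⟩ := exists_of_cokernel_π _ (x ≫ pullback.lift (f := P.σ) (g := Q.σ) 0 Q.ι
        (by simp)) (by simpa using hx)
      have h1 := hy =≫ pullback.fst _ _
      have h2 := hy =≫ pullback.snd _ _
      simp only [Category.assoc, addJ_fst, addJ_snd, pullback.lift_fst, pullback.lift_snd,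
        comp_zero] at h1 h2
      have hy0 : y = 0 := by rw [← cancel_mono P.ι, h1, zero_comp]
      rw [← cancel_mono Q.ι, ← h2, hy0, zero_comp, zero_comp]
    have h2 : Epi (cokernel.desc (addJ P Q) (pullback.fst _ _ ≫ P.σ) (by simp)) := by
      have : Epi (cokernel.π (addJ P Q) ≫ cokernel.desc (addJ P Q) (pullback.fst _ _ ≫ P.σ)
        (by simp)) := by
        rw [cokernel.π_desc]; infer_instance
      exact epi_of_epi (cokernel.π (addJ P Q)) _
    refine ShortComplex.ShortExact.mk' ?_ h1 h2
    rw [ShortComplex.exact_iff_exact_up_to_refinements]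
    intro W x hx
    dsimp at x hx
    obtain ⟨W', p, hp, l, hl⟩ := surjective_up_to_refinements_of_epi (cokernel.π _) x
    have hx' : (l ≫ pullback.fst _ _) ≫ P.σ = 0 := by
      have := p ≫= hx
      simpa [reassoc_of% hl] using this
    obtain ⟨y, hy⟩ := P.lift_ι (l ≫ pullback.fst _ _) hx'
    obtain ⟨z, hz⟩ := Q.lift_ι (l ≫ pullback.snd _ _) (by
      rw [Category.assoc, ← pullback.condition, ← Category.assoc, hx'])
    refine ⟨W', p, hp, y + z, ?_⟩
    have : l = y ≫ addJ P Q + (y + z) ≫ pullback.lift 0 Q.ι (by simp) := by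
      apply pullback.hom_ext
      · simp [hy]
      · simp [hz]
    dsimp
    rw [hl, this]
    simp

/-- The quotient map onto the middle object of the sum. -/
noncomputable def addπ : pullback P.σ Q.σ ⟶ (add P Q).E := cokernel.π (addJ P Q)

instance : Epi (addπ P Q) := inferInstanceAs (Epi (cokernel.π _))

@[simp] lemma addJ_π : addJ P Q ≫ addπ P Q = 0 := cokernel.condition _

lemma add_κ_def : pullback.lift P.κ Q.κ (by simp) ≫ addπ P Q = (add P Q).κ := rfl
lemma add_ι_def : pullback.lift 0 Q.ι (by simp) ≫ addπ P Q = (add P Q).ι := rfl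

@[simp] lemma addπ_σ : addπ P Q ≫ (add P Q).σ = pullback.fst _ _ ≫ P.σ := by
  simp [addπ, add]
@[simp] lemma addπ_ρ :
    addπ P Q ≫ (add P Q).ρ = pullback.fst _ _ ≫ P.ρ + pullback.snd _ _ ≫ Q.ρ := by
  simp [addπ, add]

lemma add_κ_eq {S : A} (k : S ⟶ pullback P.σ Q.σ) (y : S ⟶ X.neg)
    (h1 : k ≫ pullback.fst _ _ = y ≫ P.κ) (h2 : k ≫ pullback.snd _ _ = y ≫ Q.κ) :
    k ≫ addπ P Q = y ≫ (add P Q).κ := by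
  have : k = y ≫ pullback.lift P.κ Q.κ (by simp) := by
    apply pullback.hom_ext <;> simp [h1, h2]
  rw [this, Category.assoc, add_κ_def]

lemma add_ι_eq {S : A} (k : S ⟶ pullback P.σ Q.σ) (y z : S ⟶ Y.neg)
    (h1 : k ≫ pullback.fst _ _ = y ≫ P.ι) (h2 : k ≫ pullback.snd _ _ = z ≫ Q.ι) :
    k ≫ addπ P Q = (y + z) ≫ (add P Q).ι := by
  have : k = y ≫ addJ P Q + (y + z) ≫ pullback.lift 0 Q.ι (by simp) := by
    apply pullback.hom_ext <;> simp [h1, h2]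
  rw [this, Preadditive.add_comp, Category.assoc, Category.assoc, add_ι_def, addJ_π, comp_zero,
    zero_add]

lemma add_ker {W : A} (x : W ⟶ pullback P.σ Q.σ) (h : x ≫ addπ P Q = 0) :
    ∃ y : W ⟶ Y.neg, x ≫ pullback.fst _ _ = y ≫ P.ι ∧ x ≫ pullback.snd _ _ = -y ≫ Q.ι := by
  obtain ⟨y, rfl⟩ := exists_of_cokernel_π _ x h
  exact ⟨y, by simp, by simp⟩

lemma add_rel (R : Butterfly X Y) (φ : pullback P.σ Q.σ ⟶ R.E)
    (hj : addJ P Q ≫ φ = 0)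
    (hκ : pullback.lift P.κ Q.κ (by simp) ≫ φ = R.κ)
    (hι : pullback.lift 0 Q.ι (by simp) ≫ φ = R.ι)
    (hσ : φ ≫ R.σ = pullback.fst _ _ ≫ P.σ)
    (hρ : φ ≫ R.ρ = pullback.fst _ _ ≫ P.ρ + pullback.snd _ _ ≫ Q.ρ) :
    Rel (add P Q) R := by
  refine rel_of_span (addπ P Q) φ ?_ _ rfl hκ _ rfl hι (by simp [hσ]) (by simp [hρ])
  intro W x hx
  obtain ⟨y, rfl⟩ := exists_of_cokernel_π _ x hx
  simp [hj]

variable {P Q} in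
lemma add_congr {P' Q' : Butterfly X Y} (h : Rel P P') (h' : Rel Q Q') :
    Rel (add P Q) (add P' Q') := by
  obtain ⟨e, h1, h2, h3, h4⟩ := h
  obtain ⟨e', h1', h2', h3', h4'⟩ := h'
  have hm : (pullback.fst P.σ Q.σ ≫ e.hom) ≫ P'.σ = (pullback.snd P.σ Q.σ ≫ e'.hom) ≫ Q'.σ := by
    simp [h3, h3', pullback.condition]
  refine add_rel _ _ _ (pullback.lift _ _ hm ≫ addπ P' Q') ?_ ?_ ?_ ?_ ?_
  · rw [← Category.assoc, add_ι_eq P' Q' _ (𝟙 _) (-𝟙 _) (by simp [h2]) (by simp [h2']),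
      add_neg_cancel, zero_comp]
  · rw [← Category.assoc, add_κ_eq P' Q' _ (𝟙 _) (by simp [h1]) (by simp [h1']), Category.id_comp]
  · rw [← Category.assoc, add_ι_eq P' Q' _ 0 (𝟙 _) (by simp) (by simp [h2']), zero_add,
      Category.id_comp]
  · simp [h3]
  · simp [h4, h4']

lemma add_comm_rel : Rel (add P Q) (add Q P) := by
  refine add_rel _ _ _ (pullback.lift (pullback.snd _ _) (pullback.fst _ _)
    pullback.condition.symm ≫ addπ Q P) ?_ ?_ ?_ ?_ ?_
  · rw [← Category.assoc, add_ι_eq Q P _ (-𝟙 _) (𝟙 _) (by simp) (by simp), neg_add_cancel,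
      zero_comp]
  · rw [← Category.assoc, add_κ_eq Q P _ (𝟙 _) (by simp) (by simp), Category.id_comp]
  · rw [← Category.assoc, add_ι_eq Q P _ (𝟙 _) 0 (by simp) (by simp), add_zero, Category.id_comp]
  · simp [pullback.condition]
  · simp [add_comm]

lemma add_assoc_rel (R : Butterfly X Y) : Rel (add P (add Q R)) (add (add P Q) R) := by
  let S := pullback (pullback.snd P.σ (add Q R).σ) (addπ Q R)
  let s1 : S ⟶ pullback P.σ (add Q R).σ := pullback.fst _ _
  let s2 : S ⟶ pullback Q.σ R.σ := pullback.snd _ _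
  let e : S ⟶ P.E := s1 ≫ pullback.fst _ _
  let f : S ⟶ Q.E := s2 ≫ pullback.fst _ _
  let g : S ⟶ R.E := s2 ≫ pullback.snd _ _
  have hs : s1 ≫ pullback.snd _ _ = s2 ≫ addπ Q R := pullback.condition
  have hef : e ≫ P.σ = f ≫ Q.σ := by
    have : s2 ≫ addπ Q R ≫ (add Q R).σ = f ≫ Q.σ := by simp [f]
    rw [← this, ← reassoc_of% hs, ← pullback.condition]
    simp [e]
  have hfg : f ≫ Q.σ = g ≫ R.σ := by simp [f, g, pullback.condition]
  let ef : S ⟶ (add P Q).E := pullback.lift e f hef ≫ addπ P Q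
  have hefg : ef ≫ (add P Q).σ = g ≫ R.σ := by simp [ef, hef, hfg]
  have : Epi s1 := inferInstanceAs (Epi (pullback.fst _ _))
  have kκ : pullback.lift Q.κ R.κ (by simp) ≫ addπ Q R = (add Q R).κ := rfl
  refine rel_of_span (s1 ≫ addπ P (add Q R)) (pullback.lift ef g hefg ≫ addπ (add P Q) R) ?_
    (pullback.lift (pullback.lift P.κ (add Q R).κ (by simp)) (pullback.lift Q.κ R.κ (by simp))
      (by simp [kκ])) ?_ ?_
    (pullback.lift (pullback.lift 0 (add Q R).ι (by simp)) (pullback.lift 0 R.ι (by simp))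
      (by rw [pullback.lift_snd]; rfl)) ?_ ?_ ?_ ?_
  · intro V x hx
    obtain ⟨y, hy1, hy2⟩ := add_ker _ _ (x ≫ s1) (by simpa using hx)
    have h : (x ≫ s2 + y ≫ pullback.lift 0 R.ι (by simp)) ≫ addπ Q R = 0 := by
      rw [Preadditive.add_comp, Category.assoc, ← hs, ← Category.assoc, hy2,
        Category.assoc, add_ι_def]
      simp
    obtain ⟨z, hz1, hz2⟩ := add_ker _ _ _ h
    have he : x ≫ e = y ≫ P.ι := by simpa [e] using hy1
    have hf : x ≫ f = z ≫ Q.ι := by simpa using hz1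
    have hg : x ≫ g = (-z - y) ≫ R.ι := by
      simp only [Preadditive.add_comp, Category.assoc, pullback.lift_snd] at hz2
      simp [g, ← eq_sub_iff_add_eq] at hz2 ⊢
      exact hz2
    have key : x ≫ ef = (y + z) ≫ (add P Q).ι := by
      simp only [ef, ← Category.assoc]
      exact add_ι_eq P Q _ _ _ (by simp [he]) (by simp [hf])
    rw [← Category.assoc, add_ι_eq (add P Q) R _ (y + z) (-z - y) (by simp [key]) (by simp [hg])]
    simp
    abel
  · simp only [s1, ← Category.assoc, pullback.lift_fst]
    rfl
  · rw [← Category.assoc, add_κ_eq _ _ _ (𝟙 _), Category.id_comp]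
    · simp only [Category.assoc, pullback.lift_fst, Category.id_comp, ef]
      rw [← Category.assoc, add_κ_eq _ _ _ (𝟙 _), Category.id_comp]
      · simp [e, s1]
      · simp [f, s2]
    · simp [g, s2]
  · simp only [s1, ← Category.assoc, pullback.lift_fst]
    rfl
  · rw [← Category.assoc, add_ι_eq _ _ _ 0 (𝟙 _), zero_add, Category.id_comp]
    · simp only [Category.assoc, pullback.lift_fst, ef]
      rw [← Category.assoc, add_ι_eq P Q _ 0 0 (by simp [e, s1]) (by simp [f, s2]), add_zero]
    · simp [g, s2]
  · simp [ef, e]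
  · have h3 : ef ≫ (add P Q).ρ = e ≫ P.ρ + f ≫ Q.ρ := by simp [ef]
    simp [h3, reassoc_of% hs, e, f, g, add_assoc]

/-- The negative of a butterfly. -/
def neg : Butterfly X Y where
  E := P.E
  κ := P.κ
  ι := -P.ι
  σ := P.σ
  ρ := -P.ρ
  κ_σ := by simp
  ι_ρ := by simp
  κ_ρ := by simp
  ι_σ := by simp
  shortExact := by
    let e : ShortComplex.mk P.ι P.σ P.ι_σ ≅ ShortComplex.mk (-P.ι) P.σ (by simp) :=
      ShortComplex.isoMk ⟨-𝟙 _, -𝟙 _, by simp, by simp⟩ (Iso.refl _) (Iso.refl _) (by simp)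
        (by simp)
    exact ShortComplex.shortExact_of_iso e P.shortExact

variable {P Q} in
lemma neg_congr (h : Rel P Q) : Rel (neg P) (neg Q) := by
  obtain ⟨e, h1, h2, h3, h4⟩ := h
  exact ⟨e, h1, by simp [neg, h2], h3, by simp [neg, h4]⟩

end

section
variable {X Y Z : Tilt τ}

/-- Distributivity on one side. -/
lemma add_comp_rel (P P' : Butterfly X Y) (Q : Butterfly Y Z) :
    Rel (add (comp P Q) (comp P' Q)) (comp (add P P') Q) := by
  let D := pullback (comp P Q).σ (comp P' Q).σ
  let S1 := pullback (pullback.fst (comp P Q).σ (comp P' Q).σ) (compπ P Q)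
  let t : S1 ⟶ D := pullback.fst _ _
  let S := pullback (t ≫ pullback.snd (comp P Q).σ (comp P' Q).σ) (compπ P' Q)
  let s1 : S ⟶ S1 := pullback.fst _ _
  let a : S ⟶ pullback P.ρ Q.σ := s1 ≫ pullback.snd _ _
  let a' : S ⟶ pullback P'.ρ Q.σ := pullback.snd _ _
  have : Epi t := inferInstanceAs (Epi (pullback.fst _ _))
  have : Epi s1 := inferInstanceAs (Epi (pullback.fst _ _))
  have ha : (s1 ≫ t) ≫ pullback.fst _ _ = a ≫ compπ P Q := by
    simp only [a, Category.assoc, t]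
    rw [pullback.condition]
  have ha' : (s1 ≫ t) ≫ pullback.snd _ _ = a' ≫ compπ P' Q := by
    rw [Category.assoc]; exact pullback.condition
  let e : S ⟶ P.E := a ≫ pullback.fst _ _
  let f : S ⟶ Q.E := a ≫ pullback.snd _ _
  let e' : S ⟶ P'.E := a' ≫ pullback.fst _ _
  let f' : S ⟶ Q.E := a' ≫ pullback.snd _ _
  have hef : e ≫ P.ρ = f ≫ Q.σ := by simp [e, f, pullback.condition]
  have hef' : e' ≫ P'.ρ = f' ≫ Q.σ := by simp [e', f', pullback.condition]
  have hee : e ≫ P.σ = e' ≫ P'.σ := by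
    have h1 : a ≫ compπ P Q ≫ (comp P Q).σ = e ≫ P.σ := by simp [e]
    have h2 : a' ≫ compπ P' Q ≫ (comp P' Q).σ = e' ≫ P'.σ := by simp [e']
    rw [← h1, ← h2, ← reassoc_of% ha', ← pullback.condition, ← reassoc_of% ha]
  let u : S ⟶ (add P P').E := pullback.lift e e' hee ≫ addπ P P'
  have hu : u ≫ (add P P').ρ = (f + f') ≫ Q.σ := by simp [u, hef, hef']
  refine rel_of_span ((s1 ≫ t) ≫ addπ (comp P Q) (comp P' Q))
    (pullback.lift u (f + f') hu ≫ compπ (add P P') Q) ?_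
    (pullback.lift (pullback.lift (pullback.lift (comp P Q).κ (comp P' Q).κ (by simp))
      (pullback.lift P.κ 0 (by simp)) (by rw [pullback.lift_fst]; rfl))
      (pullback.lift P'.κ 0 (by simp)) ?_) ?_ ?_
    (pullback.lift (pullback.lift (pullback.lift 0 (comp P' Q).ι (by simp))
      0 (by simp)) (pullback.lift 0 Q.ι (by simp)) ?_) ?_ ?_ ?_ ?_
  · intro V x hx
    obtain ⟨y, hy1, hy2⟩ := add_ker _ _ (x ≫ s1 ≫ t) (by simpa using hx)
    have h1 : (x ≫ a - y ≫ pullback.lift 0 Q.ι (by simp)) ≫ compπ P Q = 0 := by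
      rw [Preadditive.sub_comp, Category.assoc x, Category.assoc y, comp_ι_def, ← ha,
        ← Category.assoc, hy1, sub_self]
    have h2 : (x ≫ a' + y ≫ pullback.lift 0 Q.ι (by simp)) ≫ compπ P' Q = 0 := by
      rw [Preadditive.add_comp, Category.assoc x, Category.assoc y, comp_ι_def, ← ha',
        ← Category.assoc, hy2, neg_add_cancel]
    obtain ⟨z, hz1, hz2⟩ := comp_ker _ _ _ h1
    obtain ⟨z', hz1', hz2'⟩ := comp_ker _ _ _ h2
    simp only [Preadditive.add_comp, Preadditive.sub_comp, Category.assoc, pullback.lift_snd,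
      pullback.lift_fst, comp_zero, sub_zero, add_zero, sub_eq_iff_eq_add,
      ← eq_sub_iff_add_eq] at hz1 hz2 hz1' hz2'
    have key : x ≫ u = (z + z') ≫ (add P P').ι := by
      simp only [u, ← Category.assoc]
      exact add_ι_eq _ _ _ _ _ (by simp [e, hz1]) (by simp [e', hz1'])
    have := comp_eq_of (add P P') Q (x ≫ pullback.lift u (f + f') hu) 0 (z + z') (by simp [key])
      (by simp [f, f', hz2, hz2'])
    simpa only [Category.assoc, zero_comp] using this
  · simp only [t, pullback.lift_fst_assoc, pullback.lift_snd]; rfl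
  · simp only [s1, t, Category.assoc, pullback.lift_fst_assoc]; rfl
  · rw [← Category.assoc, comp_κ_eq _ _ _ (𝟙 _), Category.id_comp]
    · simp only [Category.assoc, pullback.lift_fst, Category.id_comp, u]
      rw [← Category.assoc, add_κ_eq _ _ _ (𝟙 _), Category.id_comp]
      · simp [e, a, s1]
      · simp [e', a']
    · simp [f, f', a, s1, a']
  · simp only [t, pullback.lift_fst_assoc, pullback.lift_snd]; rfl
  · simp only [s1, t, Category.assoc, pullback.lift_fst_assoc]; rfl
  · rw [← Category.assoc, comp_ι_eq _ _ _ (𝟙 _), Category.id_comp]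
    · simp only [Category.assoc, pullback.lift_fst, u]
      rw [← Category.assoc, add_ι_eq _ _ _ 0 0 (by simp [e, a, s1]) (by simp [e', a']),
        add_zero, zero_comp]
    · simp [f, f', a, s1, a']
  · have h1 : a ≫ compπ P Q ≫ (comp P Q).σ = e ≫ P.σ := by simp [e]
    have h2 : u ≫ (add P P').σ = e ≫ P.σ := by simp [u]
    simp only [Category.assoc, compπ_σ, pullback.lift_fst_assoc, addπ_σ, h2]
    rw [← h1]
    simpa only [Category.assoc] using (ha =≫ (comp P Q).σ).symm
  · have h3 := ha =≫ (comp P Q).ρ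
    have h4 := ha' =≫ (comp P' Q).ρ
    simp only [Category.assoc] at h3 h4
    simp [h3, h4, f, f']

/-- Distributivity on the other side. -/
lemma comp_add_rel (P : Butterfly X Y) (Q Q' : Butterfly Y Z) :
    Rel (comp P (add Q Q')) (add (comp P Q) (comp P Q')) := by
  let S := pullback (pullback.snd P.ρ (add Q Q').σ) (addπ Q Q')
  let s1 : S ⟶ pullback P.ρ (add Q Q').σ := pullback.fst _ _
  let s2 : S ⟶ pullback Q.σ Q'.σ := pullback.snd _ _
  have : Epi s1 := inferInstanceAs (Epi (pullback.fst _ _))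
  let e : S ⟶ P.E := s1 ≫ pullback.fst _ _
  let f : S ⟶ Q.E := s2 ≫ pullback.fst _ _
  let f' : S ⟶ Q'.E := s2 ≫ pullback.snd _ _
  have hs : s1 ≫ pullback.snd _ _ = s2 ≫ addπ Q Q' := pullback.condition
  have hef : e ≫ P.ρ = f ≫ Q.σ := by
    have : s2 ≫ addπ Q Q' ≫ (add Q Q').σ = f ≫ Q.σ := by simp [f]
    rw [← this, ← reassoc_of% hs, ← pullback.condition]
    simp [e]
  have hff : f ≫ Q.σ = f' ≫ Q'.σ := by simp [f, f', pullback.condition]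
  have hef' : e ≫ P.ρ = f' ≫ Q'.σ := hef.trans hff
  let u : S ⟶ (comp P Q).E := pullback.lift e f hef ≫ compπ P Q
  let u' : S ⟶ (comp P Q').E := pullback.lift e f' hef' ≫ compπ P Q'
  have huu : u ≫ (comp P Q).σ = u' ≫ (comp P Q').σ := by simp [u, u']
  refine rel_of_span (s1 ≫ compπ P (add Q Q')) (pullback.lift u u' huu ≫ addπ _ _) ?_
    (pullback.lift (pullback.lift P.κ 0 (by simp)) 0 (by simp)) ?_ ?_
    (pullback.lift (pullback.lift 0 (add Q Q').ι (by simp)) (pullback.lift 0 Q'.ι (by simp))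
      (by rw [pullback.lift_snd]; rfl)) ?_ ?_ ?_ ?_
  · intro V x hx
    obtain ⟨y, hy1, hy2⟩ := comp_ker _ _ (x ≫ s1) (by simpa using hx)
    have h : (x ≫ s2 - y ≫ pullback.lift Q.κ Q'.κ (by simp)) ≫ addπ Q Q' = 0 := by
      rw [Preadditive.sub_comp, Category.assoc x, Category.assoc y, add_κ_def, ← hs, ← Category.assoc,
        hy2, sub_self]
    obtain ⟨z, hz1, hz2⟩ := add_ker _ _ _ h
    simp only [Preadditive.sub_comp, Category.assoc, pullback.lift_snd,
      pullback.lift_fst, sub_eq_iff_eq_add] at hz1 hz2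
    have h1 : x ≫ u = z ≫ (comp P Q).ι := by
      rw [← comp_ι_eq P Q (z ≫ pullback.lift 0 Q.ι (by simp)) z (by simp) (by simp)]
      simp only [u, ← Category.assoc]
      exact comp_eq_of P Q _ _ y (by simpa [e] using hy1) (by simp [f, hz1])
    have h2 : x ≫ u' = (-z) ≫ (comp P Q').ι := by
      rw [← comp_ι_eq P Q' ((-z) ≫ pullback.lift 0 Q'.ι (by simp)) (-z) (by simp) (by simp)]
      simp only [u', ← Category.assoc]
      exact comp_eq_of P Q' _ _ y (by simpa [e] using hy1) (by simp [f', hz2])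
    rw [← Category.assoc, add_ι_eq _ _ _ z (-z) (by simp [h1]) (by simp [h2]), add_neg_cancel,
      zero_comp]
  · simp only [s1, ← Category.assoc, pullback.lift_fst]; rfl
  · rw [← Category.assoc, add_κ_eq _ _ _ (𝟙 _), Category.id_comp]
    · simp only [Category.assoc, pullback.lift_fst, Category.id_comp, u]
      rw [← Category.assoc, comp_κ_eq _ _ _ (𝟙 _), Category.id_comp]
      · simp [e, s1]
      · simp [f, s2]
    · simp only [Category.assoc, pullback.lift_snd, Category.id_comp, u']
      rw [← Category.assoc, comp_κ_eq _ _ _ (𝟙 _), Category.id_comp]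
      · simp [e, s1]
      · simp [f', s2]
  · simp only [s1, ← Category.assoc, pullback.lift_fst]; rfl
  · rw [← Category.assoc, add_ι_eq _ _ _ 0 (𝟙 _), zero_add, Category.id_comp]
    · simp only [Category.assoc, pullback.lift_fst, u]
      rw [← Category.assoc, comp_ι_eq _ _ _ 0 (by simp [e, s1]) (by simp [f, s2])]
    · simp only [Category.assoc, pullback.lift_snd, u']
      rw [← Category.assoc, comp_ι_eq _ _ _ (𝟙 _) (by simp [e, s1]) (by simp [f', s2])]
  · simp [u, e]
  · simp [reassoc_of% hs, f, f', u, u']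

end

end Butterfly

/-- Morphisms of complexes `(f⁻¹, f⁰)` between objects of the tilted category. -/
@[ext] structure StrictHom (X Y : Tilt τ) where
  neg : X.neg ⟶ Y.neg
  zer : X.zer ⟶ Y.zer
  comm : X.d ≫ zer = neg ≫ Y.d

namespace StrictHom

variable {X Y Z : Tilt τ}

/-- The identity. -/
def id (X : Tilt τ) : StrictHom X X := ⟨𝟙 _, 𝟙 _, by simp⟩

/-- The composition of morphisms of complexes. -/
def comp (f : StrictHom X Y) (g : StrictHom Y Z) : StrictHom X Z :=
  ⟨f.neg ≫ g.neg, f.zer ≫ g.zer, by rw [← Category.assoc, f.comm, Category.assoc, g.comm,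
    Category.assoc]⟩

instance : Zero (StrictHom X Y) := ⟨⟨0, 0, by simp⟩⟩
instance : Add (StrictHom X Y) := ⟨fun f g => ⟨f.neg + g.neg, f.zer + g.zer, by
  simp [f.comm, g.comm]⟩⟩

@[simp] lemma id_neg : (id X).neg = 𝟙 _ := rfl
@[simp] lemma id_zer : (id X).zer = 𝟙 _ := rfl
@[simp] lemma comp_neg (f : StrictHom X Y) (g : StrictHom Y Z) :
    (f.comp g).neg = f.neg ≫ g.neg := rfl
@[simp] lemma comp_zer (f : StrictHom X Y) (g : StrictHom Y Z) :
    (f.comp g).zer = f.zer ≫ g.zer := rfl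
@[simp] lemma zero_neg : (0 : StrictHom X Y).neg = 0 := rfl
@[simp] lemma zero_zer : (0 : StrictHom X Y).zer = 0 := rfl
@[simp] lemma add_neg (f g : StrictHom X Y) : (f + g).neg = f.neg + g.neg := rfl
@[simp] lemma add_zer (f g : StrictHom X Y) : (f + g).zer = f.zer + g.zer := rfl

/-- The (split) butterfly of a morphism of complexes, with middle term `X⁰ ⊕ Y⁻¹` and
`κ = (d, -f⁻¹)`. -/
noncomputable def toButterfly (f : StrictHom X Y) : Butterfly X Y where
  E := X.zer ⊞ Y.neg
  κ := biprod.lift X.d (-f.neg)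
  ι := biprod.inr
  σ := biprod.fst
  ρ := biprod.desc f.zer Y.d
  κ_σ := by simp
  ι_ρ := by simp
  κ_ρ := by simp [f.comm]
  ι_σ := by simp
  shortExact := ShortComplex.Splitting.shortExact
    { r := biprod.snd
      s := biprod.inl }

section
variable (f : StrictHom X Y)

/-- The section `X⁰ ⟶ E` of a split butterfly. -/
noncomputable def sec : X.zer ⟶ f.toButterfly.E := biprod.inl (Y := Y.neg)
/-- The retraction `E ⟶ Y⁻¹` of a split butterfly. -/
noncomputable def ret : f.toButterfly.E ⟶ Y.neg := biprod.snd (X := X.zer)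

@[simp] lemma sec_σ : f.sec ≫ f.toButterfly.σ = 𝟙 _ := biprod.inl_fst
@[simp] lemma sec_ρ : f.sec ≫ f.toButterfly.ρ = f.zer := biprod.inl_desc _ _
@[simp] lemma sec_ret : f.sec ≫ f.ret = 0 := biprod.inl_snd
@[simp] lemma ι_ret : f.toButterfly.ι ≫ f.ret = 𝟙 _ := biprod.inr_snd
@[simp] lemma κ_ret : f.toButterfly.κ ≫ f.ret = -f.neg := biprod.lift_snd _ _
@[simp] lemma sec_σ_assoc {W : A} (h : _ ⟶ W) : f.sec ≫ f.toButterfly.σ ≫ h = h := by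
  rw [← Category.assoc, sec_σ, Category.id_comp]
@[simp] lemma sec_ρ_assoc {W : A} (h : _ ⟶ W) : f.sec ≫ f.toButterfly.ρ ≫ h = f.zer ≫ h := by
  rw [← Category.assoc, sec_ρ]
@[simp] lemma sec_ret_assoc {W : A} (h : _ ⟶ W) : f.sec ≫ f.ret ≫ h = 0 := by
  rw [← Category.assoc, sec_ret, zero_comp]
@[simp] lemma ι_ret_assoc {W : A} (h : _ ⟶ W) : f.toButterfly.ι ≫ f.ret ≫ h = h := by
  rw [← Category.assoc, ι_ret, Category.id_comp]
@[simp] lemma κ_ret_assoc {W : A} (h : _ ⟶ W) :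
    f.toButterfly.κ ≫ f.ret ≫ h = -f.neg ≫ h := by
  rw [← Category.assoc, κ_ret, Preadditive.neg_comp]

lemma hom_ext {W : A} {a b : W ⟶ f.toButterfly.E}
    (h1 : a ≫ f.toButterfly.σ = b ≫ f.toButterfly.σ) (h2 : a ≫ f.ret = b ≫ f.ret) : a = b :=
  biprod.hom_ext _ _ h1 h2

lemma hom_ext' {W : A} {a b : f.toButterfly.E ⟶ W}
    (h1 : f.sec ≫ a = f.sec ≫ b) (h2 : f.toButterfly.ι ≫ a = f.toButterfly.ι ≫ b) : a = b :=
  biprod.hom_ext' _ _ h1 h2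

lemma ρ_eq : f.toButterfly.ρ = f.toButterfly.σ ≫ f.zer + f.ret ≫ Y.d := by
  apply f.hom_ext' <;> simp

end

end StrictHom

namespace Butterfly

open StrictHom

section
variable {X Y Z X' Y' : Tilt τ}

lemma strict_comp_rel (f : StrictHom X Y) (Q : Butterfly Y Z) (R : Butterfly X Z)
    (g : R.E ⟶ Q.E) (h1 : R.κ ≫ g = f.neg ≫ Q.κ) (h2 : R.ι ≫ g = Q.ι)
    (h3 : g ≫ Q.σ = R.σ ≫ f.zer) (h4 : g ≫ Q.ρ = R.ρ) :
    Rel (comp f.toButterfly Q) R := by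
  let m : R.E ⟶ pullback f.toButterfly.ρ Q.σ := pullback.lift (R.σ ≫ f.sec) g
    (by simp [h3])
  refine (rel_of_hom (m ≫ compπ _ _) ?_ ?_ ?_ ?_).symm
  · have := comp_eq_of f.toButterfly Q (R.κ ≫ m) (pullback.lift f.toButterfly.κ 0 (by simp)) f.neg
      (by simp only [m, Category.assoc, pullback.lift_fst]
          apply f.hom_ext <;> simp) (by simp [m, h1])
    simpa only [Category.assoc, comp_κ_def] using this
  · rw [← Category.assoc, comp_ι_eq _ _ _ (𝟙 _) (by simp [m]) (by simp [m, h2]), Category.id_comp]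
  · simp [m]
  · simp [m, h4]

lemma comp_strict_rel (P : Butterfly X Y) (f : StrictHom Y Z) (R : Butterfly X Z)
    (g : P.E ⟶ R.E) (h1 : P.κ ≫ g = R.κ) (h2 : P.ι ≫ g = f.neg ≫ R.ι)
    (h3 : g ≫ R.σ = P.σ) (h4 : g ≫ R.ρ = P.ρ ≫ f.zer) :
    Rel (comp P f.toButterfly) R := by
  refine comp_rel _ _ _ (pullback.fst _ _ ≫ g + pullback.snd _ _ ≫ f.ret ≫ R.ι) ?_ ?_ ?_ ?_ ?_
  · simp [h2]
  · simp [h1]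
  · simp
  · simp [h3]
  · simp [f.ρ_eq, h4, pullback.condition_assoc]

/-- Adding a strict map to a butterfly, without changing the extension. -/
def addStrict (P : Butterfly X Y) (u : StrictHom X Y) : Butterfly X Y where
  E := P.E
  κ := P.κ - u.neg ≫ P.ι
  ι := P.ι
  σ := P.σ
  ρ := P.ρ + P.σ ≫ u.zer
  κ_σ := by simp
  ι_ρ := by simp
  κ_ρ := by simp [u.comm]
  ι_σ := by simp
  shortExact := P.shortExact

lemma add_strict_aux (P R : Butterfly X Y) (u : StrictHom X Y) (e : P.E ⟶ R.E)
    (e1 : P.κ ≫ e - u.neg ≫ R.ι = R.κ) (e2 : P.ι ≫ e = R.ι) (e3 : e ≫ R.σ = P.σ)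
    (e4 : e ≫ R.ρ = P.ρ + P.σ ≫ u.zer) : Rel (add P u.toButterfly) R := by
  have h := pullback.condition (f := P.σ) (g := u.toButterfly.σ)
  refine add_rel _ _ _ (pullback.fst _ _ ≫ e + pullback.snd _ _ ≫ u.ret ≫ R.ι) ?_ ?_ ?_ ?_ ?_
  · simp [e2]
  · simp [← e1, sub_eq_add_neg]
  · simp
  · simp [e3]
  · simp [e4, u.ρ_eq, reassoc_of% h, add_assoc]

lemma add_strict_rel (P : Butterfly X Y) (u : StrictHom X Y) :
    Rel (add P u.toButterfly) (addStrict P u) :=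
  add_strict_aux P (addStrict P u) u (𝟙 P.E)
    (congrArg (fun t => t - u.neg ≫ P.ι) (Category.comp_id P.κ)) (Category.comp_id P.ι)
    (Category.id_comp P.σ) (Category.id_comp (P.ρ + P.σ ≫ u.zer))

/-- The discrepancy of a square with strict sides that is filled on extensions. -/
lemma square_rel (P : Butterfly X Y) (P' : Butterfly X' Y') (f : StrictHom X X')
    (f' : StrictHom Y Y') (g : P.E ⟶ P'.E) (u : StrictHom X Y')
    (h2 : P.ι ≫ g = f'.neg ≫ P'.ι) (h3 : g ≫ P'.σ = P.σ ≫ f.zer)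
    (h1 : P.κ ≫ g = f.neg ≫ P'.κ + u.neg ≫ P'.ι)
    (h4 : g ≫ P'.ρ = P.ρ ≫ f'.zer + P.σ ≫ u.zer) :
    Rel (comp f.toButterfly P') (add (comp P f'.toButterfly) u.toButterfly) := by
  refine Rel.trans ?_ (add_strict_rel _ _).symm
  have hw : compJ P f'.toButterfly ≫
      (pullback.fst _ _ ≫ g + pullback.snd _ _ ≫ f'.ret ≫ P'.ι) = 0 := by
    simp [h2]
  let m : (comp P f'.toButterfly).E ⟶ P'.E := cokernel.desc _ _ hw
  have hm : compπ P f'.toButterfly ≫ m =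
      pullback.fst _ _ ≫ g + pullback.snd _ _ ≫ f'.ret ≫ P'.ι := cokernel.π_desc _ _ _
  have m1 : (comp P f'.toButterfly).κ ≫ m = P.κ ≫ g := by
    rw [← comp_κ_def, Category.assoc, hm]; simp
  have m2 : (comp P f'.toButterfly).ι ≫ m = P'.ι := by
    rw [← comp_ι_def, Category.assoc, hm]; simp
  have m3 : m ≫ P'.σ = (comp P f'.toButterfly).σ ≫ f.zer := by
    rw [← cancel_epi (compπ P f'.toButterfly), reassoc_of% hm, ← Category.assoc (compπ _ _),
      compπ_σ]
    simp [h3]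
  have m4 : m ≫ P'.ρ = (comp P f'.toButterfly).ρ + (comp P f'.toButterfly).σ ≫ u.zer := by
    rw [← cancel_epi (compπ P f'.toButterfly), reassoc_of% hm, Preadditive.comp_add, compπ_ρ,
      ← Category.assoc (compπ _ _), compπ_σ]
    simp only [Preadditive.add_comp, Category.assoc, h4, Preadditive.comp_add, f'.ρ_eq,
      pullback.condition_assoc, ι_ρ]
    abel
  have m1' : ((comp P f'.toButterfly).κ - u.neg ≫ (comp P f'.toButterfly).ι) ≫ m =
      f.neg ≫ P'.κ := by
    rw [Preadditive.sub_comp, m1, Category.assoc, m2, h1, add_sub_cancel_right]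
  exact strict_comp_rel _ _ (addStrict (comp P f'.toButterfly) u) m m1' m2 m3 m4

/-- A vanishing composition produces a link. -/
lemma exists_link (P : Butterfly X Y) (Q : Butterfly Y Z)
    (h : Rel (comp P Q) (0 : StrictHom X Z).toButterfly) :
    ∃ δ : P.E ⟶ Q.E, P.ι ≫ δ = Q.κ ∧ δ ≫ Q.σ = P.ρ ∧ P.κ ≫ δ = 0 ∧ δ ≫ Q.ρ = 0 := by
  obtain ⟨e, h1, h2, h3, h4⟩ := h
  let r : (comp P Q).E ⟶ Z.neg := e.hom ≫ ret _
  have r1 : (comp P Q).κ ≫ r = 0 := by simp [r, reassoc_of% h1]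
  have r2 : (comp P Q).ι ≫ r = 𝟙 _ := by simp [r, reassoc_of% h2]
  have r3 : r ≫ Z.d = (comp P Q).ρ := by simp [r, ← h4, ρ_eq]
  let φ : pullback P.ρ Q.σ ⟶ Q.E := pullback.snd _ _ - compπ P Q ≫ r ≫ Q.ι
  have hφ : kernel.ι (pullback.fst P.ρ Q.σ) ≫ φ = 0 := by
    obtain ⟨z, hz⟩ := Q.lift_ι (kernel.ι (pullback.fst P.ρ Q.σ) ≫ pullback.snd P.ρ Q.σ) (by
      rw [Category.assoc, ← pullback.condition, kernel.condition_assoc, zero_comp])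
    have := comp_ι_eq P Q (kernel.ι (pullback.fst P.ρ Q.σ)) z (kernel.condition _) hz.symm
    simp only [φ, Preadditive.comp_sub, reassoc_of% this, reassoc_of% r2, hz, sub_self]
  let δ : P.E ⟶ Q.E := Abelian.epiDesc (pullback.fst P.ρ Q.σ) φ hφ
  have hδ : pullback.fst P.ρ Q.σ ≫ δ = φ := Abelian.comp_epiDesc _ _ _
  refine ⟨δ, ?_, ?_, ?_, ?_⟩
  · rw [← compJ_fst P Q, Category.assoc, hδ]
    have := compJ_π P Q
    simp [φ, reassoc_of% this]
  · rw [← cancel_epi (pullback.fst P.ρ Q.σ), reassoc_of% hδ]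
    simp [φ, pullback.condition]
  · have : P.κ = pullback.lift P.κ 0 (by simp) ≫ pullback.fst P.ρ Q.σ := by simp
    rw [this, Category.assoc, hδ]
    have := comp_κ_def P Q
    simp [φ, reassoc_of% this, reassoc_of% r1]
  · rw [← cancel_epi (pullback.fst P.ρ Q.σ), reassoc_of% hδ]
    simp [φ, r3]

/-- A link forces the composition to vanish. -/
lemma comp_zero_of_link (P : Butterfly X Y) (Q : Butterfly Y Z) (δ : P.E ⟶ Q.E)
    (h1 : P.ι ≫ δ = Q.κ) (h2 : δ ≫ Q.σ = P.ρ) (h3 : P.κ ≫ δ = 0) (h4 : δ ≫ Q.ρ = 0) :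
    Rel (comp P Q) (0 : StrictHom X Z).toButterfly := by
  obtain ⟨z, hz⟩ := Q.lift_ι (pullback.snd P.ρ Q.σ - pullback.fst P.ρ Q.σ ≫ δ)
    (by simp [h2, pullback.condition])
  have hz' : z ≫ Z.d = pullback.snd P.ρ Q.σ ≫ Q.ρ := by
    rw [← Q.ι_ρ, reassoc_of% hz]; simp [h4]
  refine comp_rel _ _ _ (pullback.fst _ _ ≫ P.σ ≫ sec _ +
    z ≫ (0 : StrictHom X Z).toButterfly.ι) ?_ ?_ ?_ ?_ ?_
  · have h : compJ P Q ≫ z = 0 := by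
      rw [← cancel_mono Q.ι, Category.assoc, hz]; simp [h1]
    simp [reassoc_of% h]
  · have h : pullback.lift P.κ 0 (by simp) ≫ z = 0 := by
      rw [← cancel_mono Q.ι, Category.assoc, hz]; simp [h3]
    apply hom_ext <;> simp [reassoc_of% h]
  · have h : pullback.lift 0 Q.ι (by simp) ≫ z = 𝟙 _ := by
      rw [← cancel_mono Q.ι, Category.assoc, hz]; simp
    apply hom_ext <;> simp [reassoc_of% h]
  · simp
  · simp [hz', ρ_eq]

lemma strict_add_rel (f g : StrictHom X Y) :
    Rel (add f.toButterfly g.toButterfly) (f + g).toButterfly := by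
  have h := pullback.condition (f := f.toButterfly.σ) (g := g.toButterfly.σ)
  refine add_rel _ _ _ (pullback.fst f.toButterfly.σ g.toButterfly.σ ≫ f.toButterfly.σ ≫
    (f + g).sec + (pullback.fst f.toButterfly.σ g.toButterfly.σ ≫ f.ret +
    pullback.snd f.toButterfly.σ g.toButterfly.σ ≫ g.ret) ≫ (f + g).toButterfly.ι) ?_ ?_ ?_ ?_ ?_
  · simp
  · apply (f + g).hom_ext <;> simp [add_comm]
  · simp
  · simp
  · simp [f.ρ_eq, g.ρ_eq, ← reassoc_of% h]
    abel

lemma zero_add_rel (P : Butterfly X Y) : Rel (add (0 : StrictHom X Y).toButterfly P) P := by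
  have h := pullback.condition (f := (0 : StrictHom X Y).toButterfly.σ) (g := P.σ)
  refine add_rel _ _ _ (pullback.snd _ _ +
    pullback.fst (0 : StrictHom X Y).toButterfly.σ P.σ ≫ ret _ ≫ P.ι) ?_ ?_ ?_ ?_ ?_
  · simp
  · simp
  · simp
  · simp [h]
  · simp [ρ_eq, add_comm]

lemma neg_add_aux (N P : Butterfly X Y) (e : N.E ⟶ P.E) (e1 : N.κ ≫ e = P.κ)
    (e2 : N.ι ≫ e = -P.ι) (e3 : e ≫ P.σ = N.σ) (e4 : e ≫ P.ρ = -N.ρ) :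
    Rel (add N P) (0 : StrictHom X Y).toButterfly := by
  have hp := pullback.condition (f := N.σ) (g := P.σ)
  obtain ⟨y, hy⟩ := P.lift_ι (pullback.snd N.σ P.σ - pullback.fst N.σ P.σ ≫ e) (by simp [hp, e3])
  have hy' : y ≫ Y.d = pullback.snd N.σ P.σ ≫ P.ρ + pullback.fst N.σ P.σ ≫ N.ρ := by
    rw [← P.ι_ρ, reassoc_of% hy]; simp [e4]
  refine add_rel _ _ _ (pullback.fst N.σ P.σ ≫ N.σ ≫ sec _ +
    y ≫ (0 : StrictHom X Y).toButterfly.ι) ?_ ?_ ?_ ?_ ?_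
  · have h3 : addJ N P ≫ y = 0 := by
      rw [← cancel_mono P.ι, Category.assoc, hy]; simp [e2]
    simp [reassoc_of% h3]
  · have h3 : pullback.lift N.κ P.κ (by simp) ≫ y = 0 := by
      rw [← cancel_mono P.ι, Category.assoc, hy]; simp [e1]
    apply hom_ext <;> simp [reassoc_of% h3]
  · have h3 : pullback.lift (f := N.σ) 0 P.ι (by simp) ≫ y = 𝟙 _ := by
      rw [← cancel_mono P.ι, Category.assoc, hy]; simp
    apply hom_ext <;> simp [reassoc_of% h3]
  · simp
  · simp [hy', add_comm]

lemma neg_add_rel (P : Butterfly X Y) : Rel (add (neg P) P) (0 : StrictHom X Y).toButterfly :=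
  neg_add_aux (neg P) P (𝟙 P.E) (Category.comp_id P.κ) (Category.comp_id (-P.ι))
    (Category.id_comp P.σ) ((Category.id_comp P.ρ).trans (neg_neg P.ρ).symm)

end

end Butterfly

/-! ### The category -/

/-- Morphisms in the tilted category are isomorphism classes of butterflies. -/
noncomputable instance : CategoryStruct (Tilt τ) where
  Hom X Y := Quotient (Butterfly.setoid X Y)
  id X := Quotient.mk _ (StrictHom.id X).toButterfly
  comp := Quotient.map₂ Butterfly.comp fun _ _ h _ _ h' => Butterfly.comp_congr h h'

/-- The morphism represented by a butterfly. -/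
def Butterfly.hom {X Y : Tilt τ} (P : Butterfly X Y) : X ⟶ Y := Quotient.mk _ P

/-- The strict morphism in the tilted category given by a morphism of complexes. -/
noncomputable def StrictHom.hom {X Y : Tilt τ} (f : StrictHom X Y) : X ⟶ Y := f.toButterfly.hom

namespace Butterfly

variable {X Y Z W : Tilt τ}

lemma hom_eq {P Q : Butterfly X Y} : P.hom = Q.hom ↔ Rel P Q := Quotient.eq

lemma exists_hom (f : X ⟶ Y) : ∃ P : Butterfly X Y, P.hom = f := Quotient.exists_rep f

lemma hom_comp (P : Butterfly X Y) (Q : Butterfly Y Z) : P.hom ≫ Q.hom = (P.comp Q).hom := rfl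

lemma id_eq (X : Tilt τ) : 𝟙 X = (StrictHom.id X).hom := rfl

end Butterfly

open Butterfly

noncomputable instance : Category (Tilt τ) where
  id_comp f := by
    obtain ⟨P, rfl⟩ := exists_hom f
    exact hom_eq.2 (strict_comp_rel _ _ _ (𝟙 _) (by simp) (by simp) (by simp) (by simp))
  comp_id f := by
    obtain ⟨P, rfl⟩ := exists_hom f
    exact hom_eq.2 (comp_strict_rel _ _ _ (𝟙 _) (by simp) (by simp) (by simp) (by simp))
  assoc f g h := by
    obtain ⟨P, rfl⟩ := exists_hom f
    obtain ⟨Q, rfl⟩ := exists_hom g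
    obtain ⟨R, rfl⟩ := exists_hom h
    exact hom_eq.2 (comp_assoc_rel _ _ _).symm

noncomputable instance (X Y : Tilt τ) : Add (X ⟶ Y) where
  add := Quotient.map₂ Butterfly.add fun _ _ h _ _ h' => Butterfly.add_congr h h'

noncomputable instance (X Y : Tilt τ) : Neg (X ⟶ Y) where
  neg := Quotient.map Butterfly.neg fun _ _ h => Butterfly.neg_congr h

noncomputable instance (X Y : Tilt τ) : Zero (X ⟶ Y) where
  zero := (0 : StrictHom X Y).hom

lemma Butterfly.hom_add {X Y : Tilt τ} (P Q : Butterfly X Y) : P.hom + Q.hom = (P.add Q).hom := rfl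
lemma Butterfly.hom_neg {X Y : Tilt τ} (P : Butterfly X Y) : -P.hom = P.neg.hom := rfl
lemma StrictHom.hom_zero {X Y : Tilt τ} : (0 : StrictHom X Y).hom = 0 := rfl
lemma StrictHom.hom_id (X : Tilt τ) : (StrictHom.id X).hom = 𝟙 X := rfl

lemma StrictHom.hom_add {X Y : Tilt τ} (f g : StrictHom X Y) : (f + g).hom = f.hom + g.hom :=
  (hom_eq.2 (strict_add_rel f g)).symm

lemma StrictHom.hom_comp {X Y Z : Tilt τ} (f : StrictHom X Y) (g : StrictHom Y Z) :
    (f.comp g).hom = f.hom ≫ g.hom := by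
  refine (hom_eq.2 (strict_comp_rel f g.toButterfly (f.comp g).toButterfly
    ((f.comp g).toButterfly.σ ≫ f.zer ≫ g.sec + (f.comp g).ret ≫ g.toButterfly.ι)
    ?_ ?_ ?_ ?_)).symm
  · apply g.hom_ext <;> simp [f.comm]
  · simp
  · simp
  · simp [(f.comp g).ρ_eq]

noncomputable instance (X Y : Tilt τ) : AddCommGroup (X ⟶ Y) where
  add_assoc f g h := by
    obtain ⟨P, rfl⟩ := exists_hom f
    obtain ⟨Q, rfl⟩ := exists_hom g
    obtain ⟨R, rfl⟩ := exists_hom h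
    exact hom_eq.2 (add_assoc_rel _ _ _).symm
  zero_add f := by
    obtain ⟨P, rfl⟩ := exists_hom f
    exact hom_eq.2 (zero_add_rel P)
  add_zero f := by
    obtain ⟨P, rfl⟩ := exists_hom f
    exact hom_eq.2 ((add_comm_rel _ _).trans (zero_add_rel P))
  add_comm f g := by
    obtain ⟨P, rfl⟩ := exists_hom f
    obtain ⟨Q, rfl⟩ := exists_hom g
    exact hom_eq.2 (add_comm_rel _ _)
  neg_add_cancel f := by
    obtain ⟨P, rfl⟩ := exists_hom f
    exact hom_eq.2 (neg_add_rel P)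
  nsmul := nsmulRec
  zsmul := zsmulRec

noncomputable instance : Preadditive (Tilt τ) where
  add_comp _ _ _ f f' g := by
    obtain ⟨P, rfl⟩ := exists_hom f
    obtain ⟨P', rfl⟩ := exists_hom f'
    obtain ⟨Q, rfl⟩ := exists_hom g
    exact (hom_eq.2 (add_comp_rel P P' Q)).symm
  comp_add _ _ _ f g g' := by
    obtain ⟨P, rfl⟩ := exists_hom f
    obtain ⟨Q, rfl⟩ := exists_hom g
    obtain ⟨Q', rfl⟩ := exists_hom g'
    exact hom_eq.2 (comp_add_rel P Q Q')

lemma Butterfly.square {X Y X' Y' : Tilt τ} (P : Butterfly X Y) (P' : Butterfly X' Y')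
    (f : StrictHom X X') (f' : StrictHom Y Y') (g : P.E ⟶ P'.E) (u : StrictHom X Y')
    (h2 : P.ι ≫ g = f'.neg ≫ P'.ι) (h3 : g ≫ P'.σ = P.σ ≫ f.zer)
    (h1 : P.κ ≫ g = f.neg ≫ P'.κ + u.neg ≫ P'.ι)
    (h4 : g ≫ P'.ρ = P.ρ ≫ f'.zer + P.σ ≫ u.zer) :
    f.hom ≫ P'.hom = P.hom ≫ f'.hom + u.hom :=
  hom_eq.2 (square_rel P P' f f' g u h2 h3 h1 h4)

lemma Butterfly.square₀ {X Y X' Y' : Tilt τ} (P : Butterfly X Y) (P' : Butterfly X' Y')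
    (f : StrictHom X X') (f' : StrictHom Y Y') (g : P.E ⟶ P'.E)
    (h2 : P.ι ≫ g = f'.neg ≫ P'.ι) (h3 : g ≫ P'.σ = P.σ ≫ f.zer)
    (h1 : P.κ ≫ g = f.neg ≫ P'.κ) (h4 : g ≫ P'.ρ = P.ρ ≫ f'.zer) :
    f.hom ≫ P'.hom = P.hom ≫ f'.hom := by
  rw [square P P' f f' g 0 h2 h3 (by simp [h1]) (by simp [h4]), StrictHom.hom_zero, add_zero]

lemma Butterfly.comp_eq_zero_iff {X Y Z : Tilt τ} (P : Butterfly X Y) (Q : Butterfly Y Z) :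
    P.hom ≫ Q.hom = 0 ↔
      ∃ δ : P.E ⟶ Q.E, P.ι ≫ δ = Q.κ ∧ δ ≫ Q.σ = P.ρ ∧ P.κ ≫ δ = 0 ∧ δ ≫ Q.ρ = 0 :=
  ⟨fun h => exists_link P Q (hom_eq.1 h),
    fun ⟨δ, h1, h2, h3, h4⟩ => hom_eq.2 (comp_zero_of_link P Q δ h1 h2 h3 h4)⟩

section Linear

variable {K : Type w} [CommRing K] [Linear K A]

instance (X Y : Tilt τ) : SMul K (StrictHom X Y) :=
  ⟨fun r f => ⟨r • f.neg, r • f.zer, by simp [f.comm]⟩⟩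

@[simp] lemma StrictHom.smul_neg {X Y : Tilt τ} (r : K) (f : StrictHom X Y) :
    (r • f).neg = r • f.neg := rfl
@[simp] lemma StrictHom.smul_zer {X Y : Tilt τ} (r : K) (f : StrictHom X Y) :
    (r • f).zer = r • f.zer := rfl

/-- Scalar multiplication is composition with the endomorphism `r` of the complex `Y`. -/
noncomputable instance (X Y : Tilt τ) : SMul K (X ⟶ Y) :=
  ⟨fun r f => f ≫ (r • StrictHom.id Y).hom⟩

lemma tilt_smul_def {X Y : Tilt τ} (r : K) (f : X ⟶ Y) :
    r • f = f ≫ (r • StrictHom.id Y).hom := rfl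

noncomputable instance (X Y : Tilt τ) : Module K (X ⟶ Y) where
  one_smul f := by
    have : (1 : K) • StrictHom.id Y = StrictHom.id Y := by ext <;> simp
    rw [tilt_smul_def, this, StrictHom.hom_id, Category.comp_id]
  mul_smul r s f := by
    have : (r * s) • StrictHom.id Y = (s • StrictHom.id Y).comp (r • StrictHom.id Y) := by
      ext <;> simp [smul_smul]
    rw [tilt_smul_def, this, StrictHom.hom_comp, ← Category.assoc]; rfl
  smul_zero r := zero_comp
  smul_add r f g := Preadditive.add_comp _ _ _ _ _ _
  add_smul r s f := by
    have : (r + s) • StrictHom.id Y = r • StrictHom.id Y + s • StrictHom.id Y := by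
      ext <;> simp [add_smul]
    rw [tilt_smul_def, this, StrictHom.hom_add, Preadditive.comp_add]; rfl
  zero_smul f := by
    have : (0 : K) • StrictHom.id Y = 0 := by ext <;> simp
    rw [tilt_smul_def, this, StrictHom.hom_zero, comp_zero]

lemma StrictHom.smul_id_comp {X Y : Tilt τ} (r : K) (f : X ⟶ Y) :
    (r • StrictHom.id X).hom ≫ f = f ≫ (r • StrictHom.id Y).hom := by
  obtain ⟨P, rfl⟩ := exists_hom f
  exact square₀ P P _ _ (r • 𝟙 _) (by simp) (by simp) (by simp) (by simp)

noncomputable instance : Linear K (Tilt τ) where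
  smul_comp X Y Z r f g := by
    rw [tilt_smul_def, tilt_smul_def, Category.assoc, Category.assoc, StrictHom.smul_id_comp]
  comp_smul X Y Z f r g := by
    rw [tilt_smul_def, tilt_smul_def, Category.assoc]

lemma StrictHom.hom_smul {X Y : Tilt τ} (r : K) (f : StrictHom X Y) :
    (r • f).hom = r • f.hom := by
  have : r • f = f.comp (r • StrictHom.id Y) := by ext <;> simp
  rw [this, StrictHom.hom_comp]; rfl

end Linear

/-- A morphism of the tilted category is strict if it comes from a morphism of complexes. -/
def IsStrict {X Y : Tilt τ} (f : X ⟶ Y) : Prop := ∃ g : StrictHom X Y, g.hom = f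


end Basic

/-! ### DG categories -/

/-- A `K`-linear DG category structure on a type `C` of objects: complexes of `K`-modules
`Hom X Y`, with composition written in diagrammatic order, so that `comp h f g` is `g ∘ f`. -/
class DGCategory (K : Type w) [CommRing K] (C : Type u) where
  /-- The component of degree `n` of the complex of morphisms. -/
  Hom : C → C → ℤ → Type v
  [addCommGroup : ∀ X Y n, AddCommGroup (Hom X Y n)]
  [module : ∀ X Y n, Module K (Hom X Y n)]
  /-- The differential. -/
  d : ∀ (X Y : C) (n : ℤ), Hom X Y n →ₗ[K] Hom X Y (n + 1)
  /-- The identities. -/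
  id : ∀ X : C, Hom X X 0
  /-- The composition. -/
  comp : ∀ {X Y Z : C} {m n p : ℤ}, m + n = p → (Hom X Y m →ₗ[K] Hom Y Z n →ₗ[K] Hom X Z p)
  d_d : ∀ {X Y : C} {n : ℤ} (f : Hom X Y n), d X Y (n + 1) (d X Y n f) = 0
  id_comp : ∀ {X Y : C} {n : ℤ} (f : Hom X Y n), comp (zero_add n) (id X) f = f
  comp_id : ∀ {X Y : C} {n : ℤ} (f : Hom X Y n), comp (add_zero n) f (id Y) = f
  assoc : ∀ {X Y Z W : C} {l m n lm mn p : ℤ} (hlm : l + m = lm) (hmn : m + n = mn)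
    (h : lm + n = p) (h' : l + mn = p) (f : Hom X Y l) (g : Hom Y Z m) (k : Hom Z W n),
    comp h (comp hlm f g) k = comp h' f (comp hmn g k)
  d_id : ∀ X : C, d X X 0 (id X) = 0
  d_comp : ∀ {X Y Z : C} {m n p : ℤ} (h : m + n = p) (h₁ : m + (n + 1) = p + 1)
    (h₂ : m + 1 + n = p + 1) (f : Hom X Y m) (g : Hom Y Z n),
    d X Z p (comp h f g) =
      comp h₁ f (d Y Z n g) + n.negOnePow • comp h₂ (d X Y m f) g

attribute [reducible, instance] DGCategory.addCommGroup DGCategory.module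

section DGFunctor

variable (K : Type w) [CommRing K]

/-- A DG functor with given action `obj` on objects. -/
structure DGFunctor {C D : Type*} [DGCategory K C] [DGCategory K D] (obj : C → D) where
  /-- The action on morphisms. -/
  map : ∀ {X Y : C} {n : ℤ},
    DGCategory.Hom K X Y n →ₗ[K] DGCategory.Hom K (obj X) (obj Y) n
  map_d : ∀ {X Y : C} {n : ℤ} (f : DGCategory.Hom K X Y n),
    map (DGCategory.d X Y n f) = DGCategory.d (obj X) (obj Y) n (map f)
  map_id : ∀ X : C, map (DGCategory.id (K := K) X) = DGCategory.id (obj X)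
  map_comp : ∀ {X Y Z : C} {m n p : ℤ} (h : m + n = p) (f : DGCategory.Hom K X Y m)
    (g : DGCategory.Hom K Y Z n),
    map (DGCategory.comp h f g) = DGCategory.comp h (map f) (map g)

/-- Two objects of a DG category are isomorphic if there are mutually inverse closed morphisms
of degree zero between them. -/
def DGIsomorphic {D : Type*} [DGCategory K D] (X Y : D) : Prop :=
  ∃ (f : DGCategory.Hom K X Y 0) (g : DGCategory.Hom K Y X 0),
    DGCategory.d X Y 0 f = 0 ∧ DGCategory.d Y X 0 g = 0 ∧
    DGCategory.comp (add_zero 0) f g = DGCategory.id X ∧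
    DGCategory.comp (add_zero 0) g f = DGCategory.id Y

/-- A DG functor is a (strong) DG equivalence if it induces isomorphisms on complexes of
morphisms and every object of the target is isomorphic to an object in the image. -/
structure DGFunctor.IsEquivalence {C D : Type*} [DGCategory K C] [DGCategory K D]
    {obj : C → D} (Φ : DGFunctor K obj) : Prop where
  bijective : ∀ (X Y : C) (n : ℤ), Function.Bijective (Φ.map (X := X) (Y := Y) (n := n))
  exists_iso : ∀ Y : D, ∃ X : C, DGIsomorphic K (obj X) Y

end DGFunctor

section Basic

variable {A : Type u} [Category.{v} A] [Abelian A] {τ : TorsionTheory A}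

/-! ### Decorated complexes -/

/-- A decorated complex: a complex together with a subobject of each term (the differential
need not preserve these subobjects). -/
structure DecoratedComplex (A : Type u) [Category.{v} A] [Abelian A] where
  /-- The underlying complex. -/
  cx : CochainComplex A ℤ
  /-- The decoration. -/
  M : ∀ n : ℤ, Subobject (cx.X n)

namespace DecoratedComplex

/-- The map `Mⁿ ⟶ Eⁿ⁺¹ / Mⁿ⁺¹` induced by the differential. -/
noncomputable def conn (E : DecoratedComplex A) (n : ℤ) :
    (E.M n : A) ⟶ cokernel (E.M (n + 1)).arrow :=
  (E.M n).arrow ≫ E.cx.d n (n + 1) ≫ cokernel.π (E.M (n + 1)).arrow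

/-- The decoration is compatible with the torsion theory. -/
structure IsCompatible (E : DecoratedComplex A) (τ : TorsionTheory A) : Prop where
  ker_mem : ∀ n, τ.F (kernel (E.conn n))
  coker_mem : ∀ n, τ.T (cokernel (E.conn n))

end DecoratedComplex

/-- The objects of `Ch(A, T, F)`: decorated complexes with compatible decoration. -/
structure DecCx {A : Type u} [Category.{v} A] [Abelian A] (τ : TorsionTheory A) extends
    DecoratedComplex A where
  compatible : toDecoratedComplex.IsCompatible τ

/-- A morphism of decorated complexes: a chain map `f` with `f (Mⁿ) ⊆ Nⁿ` for all `n`. -/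
@[ext] structure DecCx.Hom (E F : DecCx τ) where
  /-- The chain map. -/
  map : E.cx ⟶ F.cx
  factors : ∀ n, (F.M n).Factors ((E.M n).arrow ≫ map.f n)

instance : Category (DecCx τ) where
  Hom := DecCx.Hom
  id E := ⟨𝟙 _, fun n => by simpa using Subobject.factors_self _⟩
  comp {E F G} f g := ⟨f.map ≫ g.map, fun n => by
    have h := Subobject.factors_comp_arrow (P := G.M n)
      ((F.M n).factorThru _ (f.factors n) ≫ (G.M n).factorThru _ (g.factors n))
    simpa using h⟩
  id_comp f := DecCx.Hom.ext (Category.id_comp f.map)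
  comp_id f := DecCx.Hom.ext (Category.comp_id f.map)
  assoc f g h := DecCx.Hom.ext (Category.assoc f.map g.map h.map)

@[simp] lemma DecCx.id_map (E : DecCx τ) : DecCx.Hom.map (𝟙 E) = 𝟙 E.cx := rfl
@[simp] lemma DecCx.comp_map {E F G : DecCx τ} (f : E ⟶ F) (g : F ⟶ G) :
    DecCx.Hom.map (f ≫ g) = f.map ≫ g.map := rfl

end Basic

lemma factors_comp {A : Type u} [Category.{v} A] {X Y Z : A} {P : Subobject Y} {Q : Subobject Z} {f : X ⟶ Y} {g : Y ⟶ Z}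
    (hf : P.Factors f) (hg : Q.Factors (P.arrow ≫ g)) : Q.Factors (f ≫ g) := by
  have := Subobject.factors_comp_arrow (P := Q) (P.factorThru f hf ≫ Q.factorThru _ hg)
  simpa using this

section Dec

open CochainComplex CochainComplex.HomComplex

variable (K : Type w) [CommRing K]
variable {A : Type u} [Category.{v} A] [Abelian A] [Linear K A] {τ : TorsionTheory A}

lemma factors_smul {X Y : A} (P : Subobject Y) (r : K) (f : X ⟶ Y) (h : P.Factors f) :
    P.Factors (r • f) := by
  have := Subobject.factors_comp_arrow (P := P) (r • P.factorThru f h)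
  simpa using this

/-- Cochains `g` (families `gₙ : Eⁿ ⟶ Fⁿ⁺ᵏ`) with `gₙ (Mⁿ) ⊆ Nⁿ⁺ᵏ` for all `n`. -/
def preserving (E F : DecoratedComplex A) (k : ℤ) : Submodule K (Cochain E.cx F.cx k) where
  carrier := {g | ∀ (p q : ℤ) (h : p + k = q), (F.M q).Factors ((E.M p).arrow ≫ g.v p q h)}
  add_mem' {a b} ha hb p q h := by
    rw [Cochain.add_v, Preadditive.comp_add]
    exact Subobject.factors_add _ _ (ha p q h) (hb p q h)
  zero_mem' p q h := by
    rw [Cochain.zero_v, comp_zero]; exact Subobject.factors_zero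
  smul_mem' r a ha p q h := by
    rw [Cochain.smul_v, Linear.comp_smul]; exact factors_smul K _ _ _ (ha p q h)

variable {K} in
lemma mem_preserving {E F : DecoratedComplex A} {k : ℤ} {g : Cochain E.cx F.cx k} :
    g ∈ preserving K E F k ↔
      ∀ (p q : ℤ) (h : p + k = q), (F.M q).Factors ((E.M p).arrow ≫ g.v p q h) := Iff.rfl

/-- The degree `k` part of the complex `hom` of decorated complexes: both the cochain and its
differential preserve the decorations. The differential of `g` is `δ_F gₙ - (-1)ᵏ gₙ₊₁ δ_E`. -/
def decHom (E F : DecoratedComplex A) (k : ℤ) : Submodule K (Cochain E.cx F.cx k) :=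
  preserving K E F k ⊓ (preserving K E F (k + 1)).comap (δ_hom K E.cx F.cx k (k + 1))

/-- The natural decoration of the complex `hom`: cochains with `gₙ (Mⁿ) = 0`
and `gₙ (Eⁿ) ⊆ Nⁿ⁺ᵏ`. -/
def decM (E F : DecoratedComplex A) (k : ℤ) : Submodule K (Cochain E.cx F.cx k) where
  carrier := {g | ∀ (p q : ℤ) (h : p + k = q),
    (E.M p).arrow ≫ g.v p q h = 0 ∧ (F.M q).Factors (g.v p q h)}
  add_mem' {a b} ha hb p q h := by
    rw [Cochain.add_v, Preadditive.comp_add, (ha p q h).1, (hb p q h).1, add_zero]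
    exact ⟨rfl, Subobject.factors_add _ _ (ha p q h).2 (hb p q h).2⟩
  zero_mem' p q h := by
    rw [Cochain.zero_v, comp_zero]; exact ⟨rfl, Subobject.factors_zero⟩
  smul_mem' r a ha p q h := by
    rw [Cochain.smul_v, Linear.comp_smul, (ha p q h).1, smul_zero]
    exact ⟨rfl, factors_smul K _ _ _ (ha p q h).2⟩

variable {K}

lemma mem_decM {E F : DecoratedComplex A} {k : ℤ} {g : Cochain E.cx F.cx k} :
    g ∈ decM K E F k ↔ ∀ (p q : ℤ) (h : p + k = q),
      (E.M p).arrow ≫ g.v p q h = 0 ∧ (F.M q).Factors (g.v p q h) := Iff.rfl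

lemma mem_decHom {E F : DecoratedComplex A} {k : ℤ} {g : Cochain E.cx F.cx k} :
    g ∈ decHom K E F k ↔
      g ∈ preserving K E F k ∧ δ k (k + 1) g ∈ preserving K E F (k + 1) := Iff.rfl

lemma decHom_le {E F : DecoratedComplex A} {k : ℤ} {g : Cochain E.cx F.cx k}
    (h : g ∈ decHom K E F k) : g ∈ preserving K E F k := h.1

lemma δ_mem_preserving {E F : DecoratedComplex A} {k l : ℤ} (hl : k + 1 = l)
    {g : Cochain E.cx F.cx k}
    (h : g ∈ decHom K E F k) : δ k l g ∈ preserving K E F l := by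
  subst hl; exact h.2

lemma δ_mem_decHom {E F : DecoratedComplex A} {k l : ℤ} (hl : k + 1 = l)
    {g : Cochain E.cx F.cx k}
    (h : g ∈ decHom K E F k) : δ k l g ∈ decHom K E F l := by
  refine mem_decHom.2 ⟨δ_mem_preserving hl h, ?_⟩
  rw [δ_δ]; exact zero_mem _

lemma preserving_comp {E F G : DecoratedComplex A} {m n p : ℤ} (h : m + n = p)
    {f : Cochain E.cx F.cx m} {g : Cochain F.cx G.cx n} (hf : f ∈ preserving K E F m)
    (hg : g ∈ preserving K F G n) : f.comp g h ∈ preserving K E G p := by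
  intro a c hac
  rw [Cochain.comp_v f g h a (a + m) c rfl (by lia), ← Category.assoc]
  exact factors_comp (hf _ _ _) (hg _ _ _)

lemma decHom_comp {E F G : DecoratedComplex A} {m n p : ℤ} (h : m + n = p)
    {f : Cochain E.cx F.cx m} {g : Cochain F.cx G.cx n} (hf : f ∈ decHom K E F m)
    (hg : g ∈ decHom K F G n) : f.comp g h ∈ decHom K E G p := by
  refine mem_decHom.2 ⟨preserving_comp h hf.1 hg.1, ?_⟩
  rw [δ_comp f g h (m + 1) (n + 1) (p + 1) rfl rfl rfl]
  refine add_mem (preserving_comp _ hf.1 hg.2) ?_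
  rw [Units.smul_def]
  exact zsmul_mem (preserving_comp _ hf.2 hg.1) _

lemma id_mem_decHom (E : DecoratedComplex A) : Cochain.ofHom (𝟙 E.cx) ∈ decHom K E E 0 := by
  refine mem_decHom.2 ⟨?_, ?_⟩
  · intro p q h
    obtain rfl : p = q := by lia
    simpa using Subobject.factors_self _
  · rw [δ_ofHom]; exact zero_mem _

lemma ofHom_mem_decHom {E F : DecCx τ} (f : E ⟶ F) :
    Cochain.ofHom f.map ∈ decHom K E.toDecoratedComplex F.toDecoratedComplex 0 := by
  refine mem_decHom.2 ⟨?_, ?_⟩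
  · intro p q h
    obtain rfl : p = q := by lia
    simpa using f.factors p
  · rw [δ_ofHom]; exact zero_mem _

lemma decM_comp {E F G : DecoratedComplex A} {m n p : ℤ} (h : m + n = p)
    {f : Cochain E.cx F.cx m} {g : Cochain F.cx G.cx n} (hf : f ∈ decM K E F m)
    (hg : g ∈ preserving K F G n) : f.comp g h ∈ decM K E G p := by
  intro a c hac
  rw [Cochain.comp_v f g h a (a + m) c rfl (by lia), ← Category.assoc, (hf _ _ _).1, zero_comp]
  exact ⟨rfl, factors_comp (hf _ _ _).2 (hg _ _ _)⟩

lemma comp_decM {E F G : DecoratedComplex A} {m n p : ℤ} (h : m + n = p)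
    {f : Cochain E.cx F.cx m} {g : Cochain F.cx G.cx n} (hf : f ∈ preserving K E F m)
    (hg : g ∈ decM K F G n) : f.comp g h ∈ decM K E G p := by
  intro a c hac
  rw [Cochain.comp_v f g h a (a + m) c rfl (by lia)]
  refine ⟨?_, Subobject.factors_of_factors_right _ (hg _ _ _).2⟩
  rw [← Category.assoc, ← Subobject.factorThru_arrow _ _ (hf a (a + m) rfl), Category.assoc,
    (hg _ _ _).1, comp_zero]

variable (K) in
/-- The submodule `Mᵏ + d Mᵏ⁻¹`. -/
def decNull (E F : DecoratedComplex A) (k : ℤ) : Submodule K (Cochain E.cx F.cx k) :=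
  decM K E F k ⊔ (decM K E F (k - 1)).map (δ_hom K E.cx F.cx (k - 1) k)

lemma decM_le_decNull {E F : DecoratedComplex A} {k : ℤ} {g : Cochain E.cx F.cx k}
    (h : g ∈ decM K E F k) : g ∈ decNull K E F k := Submodule.mem_sup_left h

lemma δ_mem_decNull {E F : DecoratedComplex A} {k l : ℤ} (hl : k + 1 = l)
    {g : Cochain E.cx F.cx k}
    (h : g ∈ decM K E F k) : δ k l g ∈ decNull K E F l := by
  obtain rfl : k = l - 1 := by lia
  exact Submodule.mem_sup_right ⟨g, h, rfl⟩

lemma mem_decNull {E F : DecoratedComplex A} {k : ℤ} {g : Cochain E.cx F.cx k} :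
    g ∈ decNull K E F k ↔ ∃ a ∈ decM K E F k, ∃ b ∈ decM K E F (k - 1),
      g = a + δ (k - 1) k b := by
  simp only [decNull, Submodule.mem_sup, Submodule.mem_map]
  constructor
  · rintro ⟨a, ha, _, ⟨b, hb, rfl⟩, rfl⟩; exact ⟨a, ha, b, hb, rfl⟩
  · rintro ⟨a, ha, b, hb, rfl⟩; exact ⟨a, ha, _, ⟨b, hb, rfl⟩, rfl⟩

lemma δ_decNull {E F : DecoratedComplex A} {k l : ℤ} (hl : k + 1 = l)
    {g : Cochain E.cx F.cx k} (h : g ∈ decNull K E F k) : δ k l g ∈ decNull K E F l := by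
  obtain ⟨a, ha, b, hb, rfl⟩ := mem_decNull.1 h
  rw [δ_add, δ_δ, add_zero]
  exact δ_mem_decNull hl ha

lemma decNull_comp {E F G : DecoratedComplex A} {m n p : ℤ} (h : m + n = p)
    {f : Cochain E.cx F.cx m} {g : Cochain F.cx G.cx n} (hf : f ∈ decNull K E F m)
    (hg : g ∈ decHom K F G n) : f.comp g h ∈ decNull K E G p := by
  obtain ⟨a, ha, b, hb, rfl⟩ := mem_decNull.1 hf
  rw [Cochain.add_comp]
  refine add_mem (decM_le_decNull (decM_comp h ha hg.1)) ?_
  have e := δ_comp b g (n₁₂ := p - 1) (by lia) m (n + 1) p (by lia) (by lia) (by lia)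
  have e' : n.negOnePow • (δ (m - 1) m b).comp g h =
      δ (p - 1) p (b.comp g (by lia)) - b.comp (δ n (n + 1) g) (by lia) := by
    rw [e, add_sub_cancel_left]
  have e'' : (δ (m - 1) m b).comp g h =
      n.negOnePow • (n.negOnePow • (δ (m - 1) m b).comp g h) := by
    rw [smul_smul, Int.units_mul_self, one_smul]
  rw [e'', e', Units.smul_def]
  exact zsmul_mem (sub_mem (δ_mem_decNull (by lia) (decM_comp _ hb hg.1))
    (decM_le_decNull (decM_comp _ hb hg.2))) _

lemma comp_decNull {E F G : DecoratedComplex A} {m n p : ℤ} (h : m + n = p)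
    {f : Cochain E.cx F.cx m} {g : Cochain F.cx G.cx n} (hf : f ∈ decHom K E F m)
    (hg : g ∈ decNull K F G n) : f.comp g h ∈ decNull K E G p := by
  obtain ⟨a, ha, b, hb, rfl⟩ := mem_decNull.1 hg
  rw [Cochain.comp_add]
  refine add_mem (decM_le_decNull (comp_decM h hf.1 ha)) ?_
  have e := δ_comp f b (n₁₂ := p - 1) (by lia) (m + 1) n p (by lia) (by lia) (by lia)
  rw [show f.comp (δ (n - 1) n b) h = _ from (sub_eq_iff_eq_add.2 e).symm, Units.smul_def]
  exact sub_mem (δ_mem_decNull (by lia) (comp_decM _ hf.1 hb))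
    (decM_le_decNull (zsmul_mem (comp_decM _ hf.2 hb) _))

variable (K) in
/-- The `k`-th term `homᵏ / (Mᵏ + d Mᵏ⁻¹)` of the complex `H⁰(hom, M)[-1]`. -/
abbrev DecHomQuot (E F : DecoratedComplex A) (k : ℤ) :=
  decHom K E F k ⧸ (decNull K E F k).submoduleOf (decHom K E F k)

namespace DecHomQuot

variable {E F G : DecoratedComplex A}

variable (K) in
/-- The class of an element of `homᵏ`. -/
def mk {k : ℤ} (g : Cochain E.cx F.cx k) (h : g ∈ decHom K E F k) : DecHomQuot K E F k :=
  Submodule.Quotient.mk ⟨g, h⟩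

lemma exists_mk {k : ℤ} (x : DecHomQuot K E F k) : ∃ g h, mk K g h = x := by
  obtain ⟨⟨g, h⟩, rfl⟩ := Submodule.Quotient.mk_surjective _ x
  exact ⟨g, h, rfl⟩

lemma mk_eq {k : ℤ} {g g' : Cochain E.cx F.cx k} {h h'} :
    mk K g h = mk K g' h' ↔ g - g' ∈ decNull K E F k := by
  rw [mk, mk, Submodule.Quotient.eq]; rfl

lemma mk_eq_zero {k : ℤ} {g : Cochain E.cx F.cx k} {h} :
    mk K g h = 0 ↔ g ∈ decNull K E F k := by
  rw [mk, Submodule.Quotient.mk_eq_zero]; rfl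

lemma mk_add {k : ℤ} {g g' : Cochain E.cx F.cx k} (h h') :
    mk K g h + mk K g' h' = mk K (g + g') (add_mem h h') := rfl

lemma mk_smul {k : ℤ} {g : Cochain E.cx F.cx k} (r : K) (h) :
    r • mk K g h = mk K (r • g) (Submodule.smul_mem _ r h) := rfl

/-- The differential, induced by the differential of cochains. -/
def d (E F : DecoratedComplex A) (k : ℤ) :
    DecHomQuot K E F k →ₗ[K] DecHomQuot K E F (k + 1) :=
  Submodule.mapQ _ _ ((δ_hom K E.cx F.cx k (k + 1)).restrict fun _ h => δ_mem_decHom rfl h)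
    fun _ h => δ_decNull rfl h

@[simp] lemma d_mk {k : ℤ} (g : Cochain E.cx F.cx k) (h) :
    d E F k (mk K g h) = mk K (δ k (k + 1) g) (δ_mem_decHom rfl h) := rfl

/-- The composition, induced by the composition of cochains. -/
def comp {m n p : ℤ} (h : m + n = p) :
    DecHomQuot K E F m →ₗ[K] DecHomQuot K F G n →ₗ[K] DecHomQuot K E G p :=
  Submodule.liftQ _
    (LinearMap.mk₂ K (fun (f : decHom K E F m) (x : DecHomQuot K F G n) =>
      Submodule.liftQ _ (Submodule.mkQ _ ∘ₗ (show decHom K F G n →ₗ[K] decHom K E G p from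
        { toFun := fun g => ⟨f.1.comp g.1 h, decHom_comp h f.2 g.2⟩
          map_add' := fun g g' => Subtype.ext (Cochain.comp_add _ _ _ h)
          map_smul' := fun r g => Subtype.ext (Cochain.comp_smul _ _ _ h) }))
        (fun g hg => (Submodule.Quotient.mk_eq_zero _).2 (comp_decNull h f.2 hg)) x)
      (by rintro f f' ⟨g⟩; exact congrArg (Submodule.Quotient.mk)
            (Subtype.ext (Cochain.add_comp _ _ _ h)))
      (by rintro r f ⟨g⟩; exact congrArg (Submodule.Quotient.mk)
            (Subtype.ext (Cochain.smul_comp _ _ _ h)))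
      (fun f x x' => map_add _ x x') (fun r f x => map_smul _ r x))
    (fun f hf => LinearMap.ext fun x => by
      obtain ⟨g, rfl⟩ := Submodule.Quotient.mk_surjective _ x
      exact (Submodule.Quotient.mk_eq_zero _).2 (decNull_comp h hf g.2))

@[simp] lemma comp_mk {m n p : ℤ} (h : m + n = p) (f : Cochain E.cx F.cx m)
    (g : Cochain F.cx G.cx n) (hf) (hg) :
    comp h (mk K f hf) (mk K g hg) = mk K (f.comp g h) (decHom_comp h hf hg) := rfl

lemma mk_congr {k : ℤ} {g g' : Cochain E.cx F.cx k} {h h'} (e : g = g') :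
    mk K g h = mk K g' h' := by subst e; rfl

end DecHomQuot

/-- The DG category of decorated complexes with compatible decoration. -/
instance : DGCategory K (DecCx τ) where
  Hom E F k := DecHomQuot K E.toDecoratedComplex F.toDecoratedComplex k
  d E F k := DecHomQuot.d E.toDecoratedComplex F.toDecoratedComplex k
  id E := DecHomQuot.mk K (Cochain.ofHom (𝟙 E.cx)) (id_mem_decHom _)
  comp h := DecHomQuot.comp h
  d_d x := by
    obtain ⟨g, h, rfl⟩ := DecHomQuot.exists_mk x
    simp only [DecHomQuot.d_mk, δ_δ]; rfl
  id_comp x := by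
    obtain ⟨g, h, rfl⟩ := DecHomQuot.exists_mk x
    exact DecHomQuot.mk_congr (Cochain.id_comp g)
  comp_id x := by
    obtain ⟨g, h, rfl⟩ := DecHomQuot.exists_mk x
    exact DecHomQuot.mk_congr (Cochain.comp_id g)
  assoc hlm hmn h h' x y z := by
    obtain ⟨f, hf, rfl⟩ := DecHomQuot.exists_mk x
    obtain ⟨g, hg, rfl⟩ := DecHomQuot.exists_mk y
    obtain ⟨k, hk, rfl⟩ := DecHomQuot.exists_mk z
    exact DecHomQuot.mk_congr (Cochain.comp_assoc f g k hlm hmn (by lia))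
  d_id E := by
    rw [DecHomQuot.d_mk, DecHomQuot.mk_eq_zero, δ_ofHom]
    exact zero_mem _
  d_comp {X Y Z m n p} h h₁ h₂ x y := by
    obtain ⟨f, hf, rfl⟩ := DecHomQuot.exists_mk x
    obtain ⟨g, hg, rfl⟩ := DecHomQuot.exists_mk y
    exact DecHomQuot.mk_congr (δ_comp f g h (m + 1) (n + 1) (p + 1) rfl rfl rfl)

end Dec

/-! ### Strict complexes -/

section Strict

open Butterfly

variable {A : Type u} [Category.{v} A] [Abelian A] {τ : TorsionTheory A}

instance (X Y : Tilt τ) : SMul ℤˣ (StrictHom X Y) :=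
  ⟨fun ε f => ⟨ε • f.neg, ε • f.zer, by simp [Units.smul_def, f.comm]⟩⟩

@[simp] lemma StrictHom.units_smul_neg {X Y : Tilt τ} (ε : ℤˣ) (f : StrictHom X Y) :
    (ε • f).neg = ε • f.neg := rfl
@[simp] lemma StrictHom.units_smul_zer {X Y : Tilt τ} (ε : ℤˣ) (f : StrictHom X Y) :
    (ε • f).zer = ε • f.zer := rfl

lemma StrictHom.hom_units_smul {X Y : Tilt τ} (ε : ℤˣ) (f : StrictHom X Y) :
    (ε • f).hom = ε • f.hom := by
  obtain rfl | rfl := Int.units_eq_one_or ε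
  · have : (1 : ℤˣ) • f = f := by ext <;> simp
    rw [this, one_smul]
  · have h : (-1 : ℤˣ) • f + f = 0 := by ext <;> simp
    have h' := StrictHom.hom_add ((-1 : ℤˣ) • f) f
    rw [h, StrictHom.hom_zero] at h'
    rw [eq_neg_of_add_eq_zero_left h'.symm]
    simp

/-- The maps `a` and `b` on the outer terms of two extensions can be completed by a map of the
middle terms:
```
  X'⁰ <-- E <-- X⁻¹
   |b     :      |a
   v      v      v
  Y'⁰ <-- F <-- Y⁻¹
```
-/
def Fillable {X' X Y' Y : Tilt τ} (E : Butterfly X' X) (F : Butterfly Y' Y)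
    (a : X.neg ⟶ Y.neg) (b : X'.zer ⟶ Y'.zer) : Prop :=
  ∃ g : E.E ⟶ F.E, E.ι ≫ g = a ≫ F.ι ∧ g ≫ F.σ = E.σ ≫ b

lemma Fillable.of_rel {X' X Y' Y : Tilt τ} {E E' : Butterfly X' X} {F F' : Butterfly Y' Y}
    {a : X.neg ⟶ Y.neg} {b : X'.zer ⟶ Y'.zer} (h : Fillable E F a b)
    (hE : E.hom = E'.hom) (hF : F.hom = F'.hom) : Fillable E' F' a b := by
  obtain ⟨g, h1, h2⟩ := h
  obtain ⟨e, -, e2, e3, -⟩ := hom_eq.1 hE.symm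
  obtain ⟨e', -, e2', e3', -⟩ := hom_eq.1 hF
  refine ⟨e.hom ≫ g ≫ e'.hom, ?_, ?_⟩
  · rw [reassoc_of% e2, reassoc_of% h1, e2']
  · simp only [Category.assoc]; rw [e3', h2, reassoc_of% e3]

variable (τ) in
/-- The objects of `Ch^st(B)`: complexes in the tilted category. -/
structure StCx where
  /-- The underlying complex. -/
  cx : CochainComplex (Tilt τ) ℤ

/-- Morphisms of `Ch^st(B)`: chain maps whose components are strict. -/
@[ext] structure StCx.Hom (X Y : StCx τ) where
  /-- The chain map. -/
  map : X.cx ⟶ Y.cx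
  strict : ∀ n, IsStrict (map.f n)

lemma IsStrict.id (X : Tilt τ) : IsStrict (𝟙 X) := ⟨StrictHom.id X, rfl⟩

lemma IsStrict.comp {X Y Z : Tilt τ} {f : X ⟶ Y} {g : Y ⟶ Z} (hf : IsStrict f)
    (hg : IsStrict g) : IsStrict (f ≫ g) := by
  obtain ⟨f, rfl⟩ := hf
  obtain ⟨g, rfl⟩ := hg
  exact ⟨f.comp g, f.hom_comp g⟩

noncomputable instance : Category (StCx τ) where
  Hom := StCx.Hom
  id _ := ⟨𝟙 _, fun _ => IsStrict.id _⟩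
  comp f g := ⟨f.map ≫ g.map, fun n => (f.strict n).comp (g.strict n)⟩
  id_comp f := StCx.Hom.ext (Category.id_comp f.map)
  comp_id f := StCx.Hom.ext (Category.comp_id f.map)
  assoc f g h := StCx.Hom.ext (Category.assoc f.map g.map h.map)

@[simp] lemma StCx.id_map (X : StCx τ) : StCx.Hom.map (𝟙 X) = 𝟙 X.cx := rfl
@[simp] lemma StCx.comp_map {X Y Z : StCx τ} (f : X ⟶ Y) (g : Y ⟶ Z) :
    StCx.Hom.map (f ≫ g) = f.map ≫ g.map := rfl

end Strict

section StrictDG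

open CochainComplex CochainComplex.HomComplex Butterfly

variable {A : Type u} [Category.{v} A] [Abelian A] {τ : TorsionTheory A}

/-- The condition on a cochain `h` of degree `k` between complexes in the tilted category to be a
morphism of degree `k` in the DG category of strict complexes. First, every component of `h` is
strict, say given by `f p q`. Second, whenever butterflies `E` and `F` represent the
differentials `Xᵖ ⟶ Xᵖ⁺¹` and `Y^q ⟶ Y^(q+1)`, with `q = p + k`, there is a map from the extension
`E` to the extension `F` inducing `(-1)ᵏ` times the `-1` component of `h` in position `p + 1` and
the `0` component of `h` in position `p`. -/
def IsStCochain {X Y : CochainComplex (Tilt τ) ℤ} {k : ℤ} (h : Cochain X Y k) : Prop :=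
  ∃ f : ∀ p q : ℤ, p + k = q → StrictHom (X.X p) (Y.X q),
    (∀ p q hpq, h.v p q hpq = (f p q hpq).hom) ∧
    ∀ (p p' q q' : ℤ) (hpq : p + k = q) (hpq' : p' + k = q'), p + 1 = p' →
      ∀ (E : Butterfly (X.X p) (X.X p')) (F : Butterfly (Y.X q) (Y.X q')),
        E.hom = X.d p p' → F.hom = Y.d q q' →
          Fillable E F (k.negOnePow • (f p' q' hpq').neg) (f p q hpq).zer

lemma IsStCochain.add {X Y : CochainComplex (Tilt τ) ℤ} {k : ℤ} {h h' : Cochain X Y k}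
    (H : IsStCochain h) (H' : IsStCochain h') : IsStCochain (h + h') := by
  obtain ⟨f, hf, hg⟩ := H
  obtain ⟨f', hf', hg'⟩ := H'
  refine ⟨fun p q hpq => f p q hpq + f' p q hpq, fun p q hpq => ?_, ?_⟩
  · rw [Cochain.add_v, hf, hf', StrictHom.hom_add]
  · intro p p' q q' hpq hpq' hp E F hE hF
    obtain ⟨g, h1, h2⟩ := hg p p' q q' hpq hpq' hp E F hE hF
    obtain ⟨g', h1', h2'⟩ := hg' p p' q q' hpq hpq' hp E F hE hF
    exact ⟨g + g', by simp [h1, h1'], by simp [h2, h2']⟩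

lemma IsStCochain.zero {X Y : CochainComplex (Tilt τ) ℤ} {k : ℤ} :
    IsStCochain (0 : Cochain X Y k) :=
  ⟨fun p q hpq => 0, fun p q hpq => by rw [Cochain.zero_v, StrictHom.hom_zero],
    fun p p' q q' hpq hpq' hp E F hE hF => ⟨0, by simp, by simp⟩⟩

lemma IsStCochain.id (X : CochainComplex (Tilt τ) ℤ) :
    IsStCochain (Cochain.ofHom (𝟙 X)) := by
  refine ⟨fun p q hpq => by obtain rfl : p = q := by lia
                            exact StrictHom.id _, fun p q hpq => ?_, ?_⟩
  · obtain rfl : p = q := by lia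
    simp [StrictHom.hom_id]
  · intro p p' q q' hpq hpq' hp E F hE hF
    obtain rfl : p = q := by lia
    obtain rfl : p' = q' := by lia
    exact Fillable.of_rel (E := E) (F := E) ⟨𝟙 _, by simp, by simp⟩ rfl (hE.trans hF.symm)

lemma IsStCochain.comp {X Y Z : CochainComplex (Tilt τ) ℤ} {m n p : ℤ} {f : Cochain X Y m}
    {g : Cochain Y Z n} (hf : IsStCochain f) (hg : IsStCochain g) (h : m + n = p) :
    IsStCochain (f.comp g h) := by
  obtain ⟨f', hf, Hf⟩ := hf
  obtain ⟨g', hg, Hg⟩ := hg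
  refine ⟨fun a c hac => (f' a (a + m) rfl).comp (g' (a + m) c (by lia)), fun a c hac => ?_, ?_⟩
  · rw [Cochain.comp_v f g h a (a + m) c rfl (by lia), hf, hg, StrictHom.hom_comp]
  · intro a a' c c' hac hac' ha E F hE hF
    subst ha
    obtain ⟨B, hB⟩ := exists_hom (Y.d (a + m) (a + 1 + m))
    obtain ⟨x, h1, h2⟩ := Hf a (a + 1) (a + m) (a + 1 + m) rfl rfl rfl E B hE hB
    obtain ⟨y, h3, h4⟩ := Hg (a + m) (a + 1 + m) c c' (by lia) (by lia) (by lia) B F hB hF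
    refine ⟨x ≫ y, ?_, ?_⟩
    · rw [reassoc_of% h1, h3]
      simp [Units.smul_def, smul_smul, ← h, Int.negOnePow_add, mul_comm]
    · rw [Category.assoc, h4, reassoc_of% h2]; simp

lemma Butterfly.exists_discrepancy {X Y X' Y' : Tilt τ} (P : Butterfly X Y) (P' : Butterfly X' Y')
    (f : StrictHom X X') (f' : StrictHom Y Y') (g : P.E ⟶ P'.E)
    (h2 : P.ι ≫ g = f'.neg ≫ P'.ι) (h3 : g ≫ P'.σ = P.σ ≫ f.zer) :
    ∃ u : StrictHom X Y', P.κ ≫ g = f.neg ≫ P'.κ + u.neg ≫ P'.ι ∧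
      g ≫ P'.ρ = P.ρ ≫ f'.zer + P.σ ≫ u.zer := by
  obtain ⟨a, ha⟩ := P'.lift_ι (P.κ ≫ g - f.neg ≫ P'.κ) (by simp [h3, f.comm])
  have hb : P.ι ≫ (g ≫ P'.ρ - P.ρ ≫ f'.zer) = 0 := by
    simp [reassoc_of% h2, f'.comm]
  let b := P.shortExact.exact.desc _ hb
  have hb' : P.σ ≫ b = g ≫ P'.ρ - P.ρ ≫ f'.zer := P.shortExact.exact.g_desc _ hb
  refine ⟨⟨a, b, ?_⟩, by simp [ha], by simp [hb']⟩
  rw [← P.κ_σ, Category.assoc, hb', ← P'.ι_ρ, reassoc_of% ha]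
  simp

lemma IsStCochain.δ {X Y : CochainComplex (Tilt τ) ℤ} {k : ℤ} {h : Cochain X Y k}
    (H : IsStCochain h) : IsStCochain (δ k (k + 1) h) := by
  obtain ⟨f, hf, H⟩ := H
  choose E hE using fun p p' => exists_hom (X.d p p')
  choose F hF using fun p p' => exists_hom (Y.d p p')
  choose g hg1 hg2 using fun p p' q q' hpq hpq' hp =>
    H p p' q q' hpq hpq' hp (E p p') (F q q') (hE p p') (hF q q')
  have hu : ∀ p r (_ : p + (k + 1) = r), ∃ u : StrictHom (X.X p) (Y.X r),
      ∀ p' q (hp : p + 1 = p') (_ : q + 1 = r) (hpq : p + k = q) (hpq' : p' + k = r),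
        (E p p').κ ≫ g p p' q r hpq hpq' hp =
          (f p q hpq).neg ≫ (F q r).κ + u.neg ≫ (F q r).ι ∧
        g p p' q r hpq hpq' hp ≫ (F q r).ρ =
          (E p p').ρ ≫ (k.negOnePow • f p' r hpq').zer + (E p p').σ ≫ u.zer := by
    intro p r hpr
    obtain ⟨u, hu⟩ := exists_discrepancy (E p (p + 1)) (F (p + k) r) (f p (p + k) rfl)
      (k.negOnePow • f (p + 1) r (by lia)) (g p (p + 1) (p + k) r rfl (by lia) rfl)
      (hg1 _ _ _ _ _ _ _) (hg2 _ _ _ _ _ _ _)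
    refine ⟨u, ?_⟩
    rintro p' q rfl hq rfl hpq'
    exact hu
  choose u hu1 hu2 using hu
  refine ⟨u, ?_, ?_⟩
  · intro p r hpr
    have := (E p (p + 1)).square (F (p + k) r) (f p (p + k) rfl)
      (k.negOnePow • f (p + 1) r (by lia)) (g p (p + 1) (p + k) r rfl (by lia) rfl) (u p r hpr)
      (hg1 _ _ _ _ _ _ _) (hg2 _ _ _ _ _ _ _)
      (hu1 p r hpr (p + 1) (p + k) rfl (by lia) rfl (by lia))
      (hu2 p r hpr (p + 1) (p + k) rfl (by lia) rfl (by lia))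
    rw [StrictHom.hom_units_smul, hE, hF] at this
    rw [δ_v k (k + 1) rfl h p r hpr (p + k) (p + 1) (by lia) rfl, hf, hf, this,
      Int.negOnePow_succ]
    simp [Units.smul_def]
  · intro p p' r r' hpr hpr' hp E' F' hE' hF'
    subst hp
    refine Fillable.of_rel (E := E p (p + 1)) (F := F r r') ?_ ((hE _ _).trans hE'.symm)
      ((hF _ _).trans hF'.symm)
    obtain ⟨x, hx1, hx2, -, -⟩ := (comp_eq_zero_iff (E p (p + 1)) (E (p + 1) (p + 1 + 1))).1
      (by rw [hE, hE]; simp)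
    obtain ⟨y, hy1, hy2, -, -⟩ := (comp_eq_zero_iff (F (p + k) r) (F r r')).1
      (by rw [hF, hF]; simp)
    have e1 := hg1 p (p + 1) (p + k) r rfl (by lia) rfl
    have e2 := hg2 (p + 1) (p + 1 + 1) r r' (by lia) (by lia) rfl
    have e3 := hu1 (p + 1) r' hpr' (p + 1 + 1) r rfl (by lia) (by lia) (by lia)
    have e4 := hu2 p r hpr (p + 1) (p + k) rfl (by lia) rfl (by lia)
    refine ⟨g p (p + 1) (p + k) r rfl (by lia) rfl ≫ y -
      k.negOnePow • x ≫ g (p + 1) (p + 1 + 1) r r' (by lia) (by lia) rfl, ?_, ?_⟩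
    · rw [Preadditive.comp_sub, reassoc_of% e1, hy1, Linear.comp_units_smul, reassoc_of% hx1, e3,
        Int.negOnePow_succ]
      simp [Units.smul_def]
    · rw [Preadditive.sub_comp, Category.assoc, hy2, Linear.units_smul_comp, Category.assoc, e2,
        reassoc_of% hx2, e4]
      simp [Units.smul_def]

lemma IsStCochain.smul {K : Type w} [CommRing K] [Linear K A]
    {X Y : CochainComplex (Tilt τ) ℤ} {k : ℤ} (r : K) {h : Cochain X Y k}
    (H : IsStCochain h) : IsStCochain (r • h) := by
  obtain ⟨f, hf, hg⟩ := H
  refine ⟨fun p q hpq => r • f p q hpq, fun p q hpq => ?_, ?_⟩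
  · rw [Cochain.smul_v, hf, StrictHom.hom_smul]
  · intro p p' q q' hpq hpq' hp E F hE hF
    obtain ⟨g, h1, h2⟩ := hg p p' q q' hpq hpq' hp E F hE hF
    refine ⟨r • g, ?_, by simp [h2]⟩
    rw [Linear.comp_smul, h1, Units.smul_def, Units.smul_def, StrictHom.smul_neg,
      smul_comm _ r]
    simp only [Linear.smul_comp]

variable (K : Type w) [CommRing K] [Linear K A]

/-- The degree `k` morphisms of the DG category of strict complexes. -/
def stHom (X Y : StCx τ) (k : ℤ) : Submodule K (Cochain X.cx Y.cx k) where
  carrier := {h | IsStCochain h}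
  add_mem' := IsStCochain.add
  zero_mem' := IsStCochain.zero
  smul_mem' r _ H := H.smul r

/-- The DG category of strict complexes, as a DG subcategory of the usual DG category of complexes
in the tilted category. -/
noncomputable instance : DGCategory K (StCx τ) where
  Hom X Y k := stHom K X Y k
  d X Y k := (δ_hom K X.cx Y.cx k (k + 1)).restrict fun _ h => IsStCochain.δ h
  id X := ⟨Cochain.ofHom (𝟙 X.cx), IsStCochain.id _⟩
  comp h := LinearMap.mk₂ K (fun f g => ⟨f.1.comp g.1 h, IsStCochain.comp f.2 g.2 h⟩)
    (fun _ _ _ => Subtype.ext (Cochain.add_comp _ _ _ h))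
    (fun _ _ _ => Subtype.ext (Cochain.smul_comp _ _ _ h))
    (fun _ _ _ => Subtype.ext (Cochain.comp_add _ _ _ h))
    (fun _ _ _ => Subtype.ext (Cochain.comp_smul _ _ _ h))
  d_d f := Subtype.ext (δ_δ _ _ _ f.1)
  id_comp f := Subtype.ext (Cochain.id_comp f.1)
  comp_id f := Subtype.ext (Cochain.comp_id f.1)
  assoc hlm hmn h h' f g k := Subtype.ext (Cochain.comp_assoc f.1 g.1 k.1 hlm hmn (by lia))
  d_id X := Subtype.ext (δ_ofHom (𝟙 X.cx))
  d_comp {X Y Z m n p} h h₁ h₂ f g :=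
    Subtype.ext (δ_comp f.1 g.1 h (m + 1) (n + 1) (p + 1) rfl rfl rfl)

end StrictDG

/-! ### The functor from decorated complexes to strict complexes -/

section Functor

open CochainComplex CochainComplex.HomComplex Butterfly

variable {A : Type u} [Category.{v} A] [Abelian A] {τ : TorsionTheory A}

namespace DecCx

/-- The object `[Mⁿ ⟶ Eⁿ⁺¹ / Mⁿ⁺¹]` of the tilted category. -/
noncomputable abbrev term (E : DecCx τ) (n : ℤ) : Tilt τ where
  neg := (E.M n : A)
  zer := cokernel (E.M (n + 1)).arrow
  d := E.conn n
  ker_mem := E.compatible.ker_mem n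
  coker_mem := E.compatible.coker_mem n

/-- The butterfly with middle term `Eⁿ⁺¹`, from the `n`-th to the `n + 1`-st term. -/
noncomputable def link (E : DecCx τ) (n : ℤ) : Butterfly (E.term n) (E.term (n + 1)) where
  E := E.cx.X (n + 1)
  κ := (E.M n).arrow ≫ E.cx.d n (n + 1)
  ι := (E.M (n + 1)).arrow
  σ := cokernel.π (E.M (n + 1)).arrow
  ρ := E.cx.d (n + 1) (n + 1 + 1) ≫ cokernel.π (E.M (n + 1 + 1)).arrow
  κ_σ := Category.assoc _ _ _
  ι_ρ := rfl
  κ_ρ := by simp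
  ι_σ := cokernel.condition _
  shortExact :=
    { exact := ShortComplex.exact_cokernel _
      mono_f := inferInstanceAs (Mono (E.M (n + 1)).arrow)
      epi_g := inferInstanceAs (Epi (cokernel.π (E.M (n + 1)).arrow)) }

lemma link_comp (E : DecCx τ) (n : ℤ) : (E.link n).hom ≫ (E.link (n + 1)).hom = 0 :=
  (comp_eq_zero_iff _ _).2 ⟨E.cx.d (n + 1) (n + 1 + 1), rfl, rfl,
    show ((E.M n).arrow ≫ E.cx.d n (n + 1)) ≫ E.cx.d (n + 1) (n + 1 + 1) = 0 by simp,
    show E.cx.d (n + 1) (n + 1 + 1) ≫ E.cx.d (n + 1 + 1) (n + 1 + 1 + 1) ≫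
      cokernel.π (E.M (n + 1 + 1 + 1)).arrow = 0 by simp⟩

/-- The complex in the tilted category attached to a decorated complex. -/
noncomputable def toStCx (E : DecCx τ) : StCx τ where
  cx := CochainComplex.of E.term (fun n => (E.link n).hom) E.link_comp

lemma toStCx_d (E : DecCx τ) (n : ℤ) : E.toStCx.cx.d n (n + 1) = (E.link n).hom :=
  CochainComplex.of_d E.term (fun n => (E.link n).hom) n

/-- The strict morphism `((-1)ᵏ gₙ, gₙ₊₁)` between the terms of the complexes attached to two
decorated complexes, induced by a cochain of degree `k`. -/
noncomputable def strictOfCochain {K : Type w} [CommRing K] [Linear K A] {E F : DecCx τ} {k : ℤ}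
    (γ : Cochain E.cx F.cx k)
    (hγ : γ ∈ decHom K E.toDecoratedComplex F.toDecoratedComplex k) (p q : ℤ) (hpq : p + k = q) :
    StrictHom (E.term p) (F.term q) where
  neg := k.negOnePow • (F.M q).factorThru ((E.M p).arrow ≫ γ.v p q hpq) (hγ.1 p q hpq)
  zer := cokernel.map _ _
    ((F.M (q + 1)).factorThru ((E.M (p + 1)).arrow ≫ γ.v (p + 1) (q + 1) (by lia))
      (hγ.1 (p + 1) (q + 1) (by lia)))
    (γ.v (p + 1) (q + 1) (by lia)) (Subobject.factorThru_arrow _ _ _).symm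
  comm := by
    have h : (F.M (q + 1)).Factors ((E.M p).arrow ≫ (δ k (k + 1) γ).v p (q + 1) (by lia)) :=
      hγ.2 p (q + 1) (by lia)
    have h' : ((E.M p).arrow ≫ (δ k (k + 1) γ).v p (q + 1) (by lia)) ≫
        cokernel.π (F.M (q + 1)).arrow = 0 := by
      rw [← Subobject.factorThru_arrow _ _ h, Category.assoc, cokernel.condition, comp_zero]
    rw [δ_v k (k + 1) rfl γ p (q + 1) (by lia) q (p + 1) (by lia) rfl, Int.negOnePow_succ] at h'
    simp only [Units.smul_def, Units.val_neg, neg_smul, ← sub_eq_add_neg, Preadditive.comp_sub,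
      Preadditive.sub_comp, Preadditive.comp_zsmul, Preadditive.zsmul_comp, Category.assoc,
      sub_eq_zero] at h'
    simp only [DecoratedComplex.conn, Units.smul_def, Category.assoc, cokernel.π_desc,
      Preadditive.zsmul_comp, Subobject.factorThru_arrow_assoc, h', smul_smul]
    simp [← Units.val_mul]

/-- The strict morphism induced by a morphism of decorated complexes on the `n`-th terms. -/
noncomputable def termMap {E F : DecCx τ} (f : E ⟶ F) (n : ℤ) :
    StrictHom (E.term n) (F.term n) where
  neg := (F.M n).factorThru ((E.M n).arrow ≫ f.map.f n) (f.factors n)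
  zer := cokernel.map _ _
    ((F.M (n + 1)).factorThru ((E.M (n + 1)).arrow ≫ f.map.f (n + 1)) (f.factors (n + 1)))
    (f.map.f (n + 1)) (Subobject.factorThru_arrow _ _ _).symm
  comm := by simp [DecoratedComplex.conn]

lemma termMap_comm {E F : DecCx τ} (f : E ⟶ F) (n : ℤ) :
    (termMap f n).hom ≫ (F.link n).hom = (E.link n).hom ≫ (termMap f (n + 1)).hom :=
  square₀ _ _ _ _ (f.map.f (n + 1))
    (Subobject.factorThru_arrow _ _ (f.factors (n + 1))).symm
    (cokernel.π_desc _ _ _).symm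
    (show ((E.M n).arrow ≫ E.cx.d n (n + 1)) ≫ f.map.f (n + 1) =
      (F.M n).factorThru _ (f.factors n) ≫ (F.M n).arrow ≫ F.cx.d n (n + 1) by simp)
    (show f.map.f (n + 1) ≫ F.cx.d (n + 1) (n + 1 + 1) ≫ cokernel.π (F.M (n + 1 + 1)).arrow =
      (E.cx.d (n + 1) (n + 1 + 1) ≫ cokernel.π (E.M (n + 1 + 1)).arrow) ≫
        (termMap f (n + 1)).zer by simp [termMap])

lemma termMap_id (E : DecCx τ) (n : ℤ) : termMap (𝟙 E) n = StrictHom.id (E.term n) := by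
  ext
  · simp [termMap]
  · simp [termMap]

lemma termMap_comp {E F H : DecCx τ} (f : E ⟶ F) (g : F ⟶ H) (n : ℤ) :
    termMap (f ≫ g) n = (termMap f n).comp (termMap g n) := by
  ext
  · simp [termMap]
  · simp [termMap]

end DecCx

variable (τ) in
/-- The functor `G : Ch(A, T, F) ⥤ Ch^st(B)`. -/
noncomputable def G : DecCx τ ⥤ StCx τ where
  obj E := E.toStCx
  map {E F} f :=
    { map := CochainComplex.ofHom (fun n => (DecCx.termMap f n).hom)
        (fun n => by rw [DecCx.toStCx_d, DecCx.toStCx_d]; exact DecCx.termMap_comm f n)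
      strict := fun n => ⟨DecCx.termMap f n, rfl⟩ }
  map_id E := by
    apply StCx.Hom.ext
    ext n
    exact (congrArg StrictHom.hom (E.termMap_id n)).trans (StrictHom.hom_id _)
  map_comp f g := by
    apply StCx.Hom.ext
    ext n
    exact (congrArg StrictHom.hom (DecCx.termMap_comp f g n)).trans (StrictHom.hom_comp _ _)

end Functor

end HRS

namespace HRS

universe w v u

open CochainComplex CochainComplex.HomComplex Butterfly

variable {A : Type u} [Category.{v} A] [Abelian A] {τ : TorsionTheory A}

/-! The decorated complex is a way to glue a chain of butterflies. In `G (E, M)` the differential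
out of the `n`-th term is the extension of `Eⁿ⁺¹ / Mⁿ⁺¹` by `Mⁿ⁺¹` with middle term `Eⁿ⁺¹`, so the
middle terms of the butterflies recover `E`, and the links between consecutive butterflies recover
its differential.

Morphisms. A family `γ` of degree `k` that preserves the decorations acts on subobjects and
quotients. Its action is compatible with the maps `Mⁿ ⟶ Eⁿ⁺¹ / Mⁿ⁺¹`, up to the sign `(-1)ᵏ`,
because `dγ` preserves the decorations as well. The components of `γ` are themselves the fillings
that the definition of `Ch^st(B)` demands. Conversely, a choice of fillings for a strict family is a
cochain `γ`, and the commutation of each strict square says that `dγ` preserves the decorations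
(`DecCx.exists_stCochain_eq`). The filled squares measure the failure of commutation with the
differentials: their discrepancy is the strict morphism induced by `dγ` (`DecCx.link_square`),
whence compatibility with `d`.

Kernel. A strict morphism is zero in the tilt exactly when it is null-homotopic
(`StrictHom.hom_eq_zero_iff`). A family of homotopies `Eᵖ⁺¹ / Mᵖ⁺¹ ⟶ N^q`, with `q = p + k`, is the
same as an element `b` of degree `k - 1` in the natural decoration of `hom`. The homotopies say that
`γ - db` vanishes on every `M` and maps into every `N`, that is, lies in the decoration in degree
`k`. So the kernel is exactly the submodule by which the Hom modules are divided
(`DecCx.stCochain_eq_zero_of_mem`, `DecCx.mem_decNull_of_stCochain_eq_zero`).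

Objects. For a complex in the tilt, choose butterflies representing the differentials. The vanishing
of consecutive compositions gives link maps between their middle terms. Two consecutive links
compose to zero, since the composite factors through a map from the cokernel of one object of the
tilt to the kernel of another, hence from `T` to `F` (`Butterfly.link_comp_link`). The middle terms
thus form a complex, decorated by the images of the maps `ι`, and `G` returns the original complex
up to strict isomorphism. -/

/-! ### Strict morphisms that vanish in the tilt -/

/-- A strict morphism vanishes in the tilted category iff it is null-homotopic. -/
lemma StrictHom.hom_eq_zero_iff {X Y : Tilt τ} (f : StrictHom X Y) :
    f.hom = 0 ↔ ∃ s : X.zer ⟶ Y.neg, f.neg = X.d ≫ s ∧ f.zer = s ≫ Y.d := by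
  rw [← StrictHom.hom_zero]
  refine Butterfly.hom_eq.trans ⟨?_, ?_⟩
  · rintro ⟨e, h1, h2, h3, h4⟩
    -- Both butterflies split and `e` respects `ι` and `σ`, so `e` is a unipotent triangular matrix.
    -- Its off-diagonal entry `X⁰ ⟶ Y⁻¹` is the homotopy; compatibility with `κ` and with `ρ` gives
    -- the two equations.
    have hs : f.sec ≫ e.hom = (0 : StrictHom X Y).sec +
        (f.sec ≫ e.hom ≫ (0 : StrictHom X Y).ret) ≫ (0 : StrictHom X Y).toButterfly.ι := by
      apply StrictHom.hom_ext
      · simp [h3]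
      · simp
    have hκ : f.toButterfly.κ = X.d ≫ f.sec - f.neg ≫ f.toButterfly.ι := by
      apply StrictHom.hom_ext <;> simp
    refine ⟨f.sec ≫ e.hom ≫ (0 : StrictHom X Y).ret, ?_, ?_⟩
    · have := h1 =≫ (0 : StrictHom X Y).ret
      rw [hκ] at this
      simp only [Preadditive.sub_comp, Category.assoc, reassoc_of% h2, StrictHom.ι_ret,
        StrictHom.κ_ret, StrictHom.zero_neg, neg_zero, Category.comp_id] at this
      exact (sub_eq_zero.1 this).symm
    · have := hs =≫ (0 : StrictHom X Y).toButterfly.ρ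
      simpa [h4] using this
  · rintro ⟨s, h1, h2⟩
    -- The shear `(x, y) ↦ (x, s x + y)` of `X⁰ ⊕ Y⁻¹`.
    refine rel_of_hom (f.toButterfly.σ ≫ (0 : StrictHom X Y).sec +
      (f.toButterfly.σ ≫ s + f.ret) ≫ (0 : StrictHom X Y).toButterfly.ι) ?_ ?_ ?_ ?_
    · apply StrictHom.hom_ext <;> simp [h1]
    · simp
    · simp
    · simp [f.ρ_eq, h2]

/-! ### From cochains of decorated complexes to strict cochains -/

namespace DecCx

variable {E F H : DecCx τ}

lemma strictHom_ext {X : Tilt τ} {q : ℤ} {f g : StrictHom X (F.term q)}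
    (h1 : f.neg ≫ (F.M q).arrow = g.neg ≫ (F.M q).arrow) (h2 : f.zer = g.zer) : f = g :=
  StrictHom.ext ((cancel_mono _).1 h1) h2

/-- The components of `strictOfCochain` are a factorization through a subobject and a map induced on
quotients. They are determined by composing with the monomorphism `arrow` and the epimorphism
`cokernel.π`, where they become the cochain itself. -/
lemma strictHom_ext' {p q : ℤ} {f g : StrictHom (E.term p) (F.term q)}
    (h1 : f.neg ≫ (F.M q).arrow = g.neg ≫ (F.M q).arrow)
    (h2 : cokernel.π (E.M (p + 1)).arrow ≫ f.zer = cokernel.π (E.M (p + 1)).arrow ≫ g.zer) :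
    f = g :=
  strictHom_ext h1 ((cancel_epi _).1 h2)

section

variable {K : Type w} [CommRing K] [Linear K A] {k : ℤ} (γ : Cochain E.cx F.cx k)
  (hγ : γ ∈ decHom K E.toDecoratedComplex F.toDecoratedComplex k) (p q : ℤ) (hpq : p + k = q)

@[simp] lemma strictOfCochain_neg_arrow :
    (strictOfCochain γ hγ p q hpq).neg ≫ (F.M q).arrow =
      k.negOnePow • (E.M p).arrow ≫ γ.v p q hpq := by
  simp [strictOfCochain, Units.smul_def]

@[simp] lemma π_strictOfCochain_zer :
    cokernel.π (E.M (p + 1)).arrow ≫ (strictOfCochain γ hγ p q hpq).zer =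
      γ.v (p + 1) (q + 1) (by lia) ≫ cokernel.π (F.M (q + 1)).arrow := by
  simp [strictOfCochain]

variable {γ} in
lemma strictOfCochain_add {γ' : Cochain E.cx F.cx k}
    (hγ' : γ' ∈ decHom K E.toDecoratedComplex F.toDecoratedComplex k) :
    strictOfCochain (γ + γ') (add_mem hγ hγ') p q hpq =
      strictOfCochain γ hγ p q hpq + strictOfCochain γ' hγ' p q hpq := by
  apply strictHom_ext' <;> simp

lemma strictOfCochain_smul (r : K) :
    strictOfCochain (r • γ) (Submodule.smul_mem _ r hγ) p q hpq =
      r • strictOfCochain γ hγ p q hpq := by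
  apply strictHom_ext'
  · rw [strictOfCochain_neg_arrow, StrictHom.smul_neg, Linear.smul_comp, strictOfCochain_neg_arrow,
      Cochain.smul_v, Linear.comp_smul, Units.smul_def, Units.smul_def, smul_comm]
  · simp

/-- The signs on the `-1` components multiply: `(-1)ᵏ (-1)ˡ = (-1)ᵏ⁺ˡ`. No sign enters on the `0`
components. -/
lemma strictOfCochain_comp {l m : ℤ} (h : k + l = m) (β : Cochain F.cx H.cx l)
    (hβ : β ∈ decHom K F.toDecoratedComplex H.toDecoratedComplex l) (r : ℤ) (hqr : q + l = r) :
    strictOfCochain (γ.comp β h) (decHom_comp h hγ hβ) p r (by lia) =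
      (strictOfCochain γ hγ p q hpq).comp (strictOfCochain β hβ q r hqr) := by
  apply strictHom_ext'
  · have e := strictOfCochain_neg_arrow γ hγ p q hpq
    simp [Cochain.comp_v γ β h p q r hpq hqr, ← h, Int.negOnePow_add, Units.smul_def,
      reassoc_of% e, smul_smul, mul_comm]
  · have e := π_strictOfCochain_zer γ hγ p q hpq
    simp [Cochain.comp_v γ β h (p + 1) (q + 1) (r + 1) (by lia) (by lia), reassoc_of% e]

lemma strictOfCochain_ofHom (f : E ⟶ F) (n : ℤ) :
    strictOfCochain (K := K) (Cochain.ofHom f.map) (ofHom_mem_decHom f) n n (add_zero n) =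
      termMap f n := by
  apply strictHom_ext' <;> simp [termMap]

/-- The component of `γ` in position `p + 1` is a map of the middle terms of the two links. It fills
the square on the extensions but need not respect `κ` and `ρ`, and the discrepancies there are the
two components of the strict morphism attached to `dγ`. On the `-1` side, `δ_E γₚ₊₁ - (-1)ᵏ δ_F γₚ`
equals `(-1)ᵏ⁺¹ dγ`, which explains the sign in `strictOfCochain`. -/
lemma link_square :
    (strictOfCochain γ hγ p q hpq).hom ≫ (F.link q).hom =
      (E.link p).hom ≫
        (k.negOnePow • strictOfCochain γ hγ (p + 1) (q + 1) (by lia)).hom +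
      (strictOfCochain (δ k (k + 1) γ) (δ_mem_decHom rfl hγ) p (q + 1) (by lia)).hom := by
  refine Butterfly.square _ _ _ _ (γ.v (p + 1) (q + 1) (by lia)) _ ?_ ?_ ?_ ?_
  · change (E.M (p + 1)).arrow ≫ _ = _ ≫ (F.M (q + 1)).arrow
    simp [Units.smul_def, smul_smul, ← Units.val_mul]
  · exact (π_strictOfCochain_zer γ hγ p q hpq).symm
  · have e1 := strictOfCochain_neg_arrow γ hγ p q hpq =≫ F.cx.d q (q + 1)
    have e2 := strictOfCochain_neg_arrow _ (δ_mem_decHom rfl hγ) p (q + 1) (by lia)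
    -- The goal with the fields of the links unfolded, so that the rewriting rules apply; the two
    -- forms agree definitionally.
    have e3 : ((E.M p).arrow ≫ E.cx.d p (p + 1)) ≫ γ.v (p + 1) (q + 1) (by lia) =
        (strictOfCochain γ hγ p q hpq).neg ≫ (F.M q).arrow ≫ F.cx.d q (q + 1) +
          (strictOfCochain _ (δ_mem_decHom rfl hγ) p (q + 1) (by lia)).neg ≫
            (F.M (q + 1)).arrow := by
      rw [e2, ← Category.assoc _ (F.M q).arrow, e1,
        δ_v k (k + 1) rfl γ p (q + 1) (by lia) q (p + 1) (by lia) rfl]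
      simp [Units.smul_def, Int.negOnePow_succ, smul_smul, ← Units.val_mul]
    exact e3
  · have e1 := π_strictOfCochain_zer γ hγ (p + 1) (q + 1) (by lia)
    have e2 := π_strictOfCochain_zer _ (δ_mem_decHom rfl hγ) p (q + 1) (by lia)
    have e3 : γ.v (p + 1) (q + 1) (by lia) ≫ F.cx.d (q + 1) (q + 1 + 1) ≫
          cokernel.π (F.M (q + 1 + 1)).arrow =
        (E.cx.d (p + 1) (p + 1 + 1) ≫ cokernel.π (E.M (p + 1 + 1)).arrow) ≫
          (k.negOnePow • (strictOfCochain γ hγ (p + 1) (q + 1) (by lia)).zer) +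
        cokernel.π (E.M (p + 1)).arrow ≫
          (strictOfCochain _ (δ_mem_decHom rfl hγ) p (q + 1) (by lia)).zer := by
      rw [e2, Linear.comp_units_smul, Category.assoc, e1,
        δ_v k (k + 1) rfl γ (p + 1) (q + 1 + 1) (by lia) (q + 1) (p + 1 + 1) (by lia) rfl]
      simp [Units.smul_def, Int.negOnePow_succ]
    exact e3

/-- The filling is the component of `γ` in position `p + 1`. The sign `(-1)ᵏ` in the filling
condition cancels the one in `strictOfCochain`. -/
lemma link_fillable :
    Fillable (E.link p) (F.link q)
      (k.negOnePow • (strictOfCochain γ hγ (p + 1) (q + 1) (by lia)).neg)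
      (strictOfCochain γ hγ p q hpq).zer := by
  refine ⟨γ.v (p + 1) (q + 1) (by lia), ?_, (π_strictOfCochain_zer γ hγ p q hpq).symm⟩
  change (E.M (p + 1)).arrow ≫ _ = _ ≫ (F.M (q + 1)).arrow
  simp [Units.smul_def, smul_smul, ← Units.val_mul]

/-- The cochain between complexes in the tilted category induced by a cochain between decorated
complexes. -/
noncomputable def stCochain : Cochain E.toStCx.cx F.toStCx.cx k :=
  Cochain.mk fun p q hpq => (strictOfCochain γ hγ p q hpq).hom

@[simp] lemma stCochain_v :
    (stCochain γ hγ).v p q hpq = (strictOfCochain γ hγ p q hpq).hom := rfl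

lemma isStCochain_stCochain : IsStCochain (stCochain γ hγ) := by
  refine ⟨fun p q hpq => strictOfCochain γ hγ p q hpq, fun p q hpq => rfl, ?_⟩
  rintro p p' q q' hpq hpq' rfl E' F' hE hF
  obtain rfl : q' = q + 1 := by lia
  -- The condition ranges over all butterflies representing the differentials, but fillability
  -- depends only on their isomorphism classes.
  exact (link_fillable γ hγ p q hpq).of_rel ((E.toStCx_d p).symm.trans hE.symm)
    ((F.toStCx_d q).symm.trans hF.symm)

/-- This is `link_square` in each position, with the term through `E.link p` moved to the other
side: the sign `(-1)ᵏ⁺¹` of the second summand of `δ` is the negative of the sign in the square. -/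
lemma δ_stCochain :
    δ k (k + 1) (stCochain γ hγ) = stCochain (δ k (k + 1) γ) (δ_mem_decHom rfl hγ) := by
  ext p r hpr
  obtain ⟨q, rfl⟩ : ∃ q, r = q + 1 := ⟨r - 1, by lia⟩
  rw [δ_v k (k + 1) rfl _ p (q + 1) hpr q (p + 1) (by lia) rfl, toStCx_d, toStCx_d, stCochain_v,
    stCochain_v, stCochain_v]
  have e := link_square γ hγ p q (by lia)
  rw [StrictHom.hom_units_smul, Linear.comp_units_smul] at e
  rw [Int.negOnePow_succ, Units.neg_smul, ← sub_eq_add_neg]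
  exact sub_eq_of_eq_add' e

variable (K E F k) in
/-- The passage from cochains between decorated complexes to cochains between complexes in the
tilted category, as a linear map. -/
noncomputable def stCochainHom :
    decHom K E.toDecoratedComplex F.toDecoratedComplex k →ₗ[K] stHom K E.toStCx F.toStCx k where
  toFun γ := ⟨stCochain γ.1 γ.2, isStCochain_stCochain γ.1 γ.2⟩
  map_add' γ γ' := by
    apply Subtype.ext
    ext p q hpq
    exact (congrArg StrictHom.hom (strictOfCochain_add γ.2 p q hpq γ'.2)).trans
      (StrictHom.hom_add _ _)
  map_smul' r γ := by
    apply Subtype.ext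
    ext p q hpq
    exact (congrArg StrictHom.hom (strictOfCochain_smul γ.1 γ.2 p q hpq r)).trans
      (StrictHom.hom_smul _ _)

end

end DecCx

/-! ### Choosing families indexed by successors -/

/-- Every integer is `n + 1` for a unique `n`. Links and their fillings naturally live in degree `n
+ 1`, and this turns choices there into a family over all degrees without leaving a transport in the
result. -/
lemma exists_forall_succ {α : ℤ → Sort*} (P : ∀ n, α (n + 1) → Prop) (h : ∀ n, ∃ x, P n x) :
    ∃ f : ∀ n, α n, ∀ n, P n (f (n + 1)) := by
  -- Quantifying over the equation `m = n + 1` absorbs the transport: for `m` literally `n + 1` it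
  -- is the identity.
  have h' : ∀ m, ∃ x : α m, ∀ n (e : m = n + 1), P n (e ▸ x) := by
    intro m
    obtain ⟨n, rfl⟩ : ∃ n, m = n + 1 := ⟨m - 1, by lia⟩
    obtain ⟨x, hx⟩ := h n
    refine ⟨x, fun n' e => ?_⟩
    obtain rfl : n = n' := by lia
    exact hx
  choose f hf using h'
  exact ⟨f, fun n => hf (n + 1) n rfl⟩

/-- Apply `exists_forall_succ` in the source degree and then in the target degree. Values in
different positions are chosen independently, as a cochain satisfies no compatibility. -/
lemma exists_cochain {X Y : CochainComplex A ℤ} {k : ℤ}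
    (Q : ∀ p q : ℤ, p + k = q → (X.X (p + 1) ⟶ Y.X (q + 1)) → Prop)
    (h : ∀ p q hpq, ∃ x, Q p q hpq x) :
    ∃ γ : Cochain X Y k, ∀ p q hpq, Q p q hpq (γ.v (p + 1) (q + 1) (by lia)) := by
  obtain ⟨γ, hγ⟩ := exists_forall_succ (α := fun m => ∀ l, m + k = l → (X.X m ⟶ Y.X l))
    (fun p x => ∀ q (hpq : p + k = q), Q p q hpq (x (q + 1) (by lia)))
    (fun p => by
      obtain ⟨x, hx⟩ := exists_forall_succ
        (α := fun l => p + 1 + k = l → (X.X (p + 1) ⟶ Y.X l))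
        (fun q x => ∀ hpq : p + k = q, Q p q hpq (x (by lia)))
        (fun q => by
          by_cases hpq : p + k = q
          · obtain ⟨x, hx⟩ := h p q hpq
            exact ⟨fun _ => x, fun _ => hx⟩
          -- The default value is irrelevant: off the line `p + k = q` the condition is empty.
          · exact ⟨fun _ => 0, fun h => (hpq h).elim⟩)
      exact ⟨x, hx⟩)
  exact ⟨Cochain.mk γ, fun p q hpq => hγ p q hpq⟩

lemma factors_iff_comp_π {X Y : A} {P : Subobject Y} {f : X ⟶ Y} :
    P.Factors f ↔ f ≫ cokernel.π P.arrow = 0 := by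
  constructor
  · intro h
    rw [← P.factorThru_arrow f h, Category.assoc, cokernel.condition, comp_zero]
  · intro h
    obtain ⟨y, rfl⟩ := exists_of_cokernel_π P.arrow f h
    exact P.factors_comp_arrow y

/-! ### Kernel and image of the passage to strict cochains -/

namespace DecCx

variable {E F : DecCx τ} {K : Type w} [CommRing K] [Linear K A] {k : ℤ}

section

variable (γ : Cochain E.cx F.cx k)
  (hγ : γ ∈ decHom K E.toDecoratedComplex F.toDecoratedComplex k)

/-- An element of `decM` acts as zero on the subobjects and on the quotients. A coboundary `δ b`
with `b` in `decM` acts by null-homotopic strict morphisms, the homotopies being induced by `b`. -/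
lemma stCochain_eq_zero_of_mem (h : γ ∈ decNull K E.toDecoratedComplex F.toDecoratedComplex k) :
    stCochain γ hγ = 0 := by
  obtain ⟨a, ha, b, hb, rfl⟩ := mem_decNull.1 h
  ext p q hpq
  rw [stCochain_v, Cochain.zero_v]
  obtain ⟨hb1, hb2⟩ := hb (p + 1) q (by lia)
  -- The map `b` kills `Mᵖ⁺¹` and lands in `N^q`, so it descends to a map from the `0` part of the
  -- `p`-th term of the source to the `-1` part of the `q`-th term of the target.
  obtain ⟨s, hs⟩ : ∃ s : cokernel (E.M (p + 1)).arrow ⟶ (F.M q : A),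
      cokernel.π _ ≫ s ≫ (F.M q).arrow = b.v (p + 1) q (by lia) :=
    ⟨cokernel.desc _ ((F.M q).factorThru _ hb2) (by
      rw [← cancel_mono (F.M q).arrow, Category.assoc, Subobject.factorThru_arrow, hb1,
        zero_comp]), by simp⟩
  refine (StrictHom.hom_eq_zero_iff _).2 ⟨s, ?_, ?_⟩
  -- On `Mᵖ` only the summand `(-1)ᵏ δ_E b` of `δ b` survives, and its sign cancels that of
  -- `strictOfCochain`. In the other component only the summand `δ_F b` survives, without a sign.
  · rw [← cancel_mono (F.M q).arrow, strictOfCochain_neg_arrow, Cochain.add_v,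
      Preadditive.comp_add, (ha p q hpq).1, zero_add,
      δ_v (k - 1) k (by lia) b p q hpq (q - 1) (p + 1) (by lia) rfl, Preadditive.comp_add,
      ← Category.assoc, (hb p (q - 1) (by lia)).1, zero_comp, zero_add]
    simp [DecoratedComplex.conn, hs, Units.smul_def, smul_smul, ← Units.val_mul]
  · rw [← cancel_epi (cokernel.π (E.M (p + 1)).arrow), π_strictOfCochain_zer, Cochain.add_v,
      Preadditive.add_comp, factors_iff_comp_π.1 (ha (p + 1) (q + 1) (by lia)).2, zero_add,
      δ_v (k - 1) k (by lia) b (p + 1) (q + 1) (by lia) q (p + 1 + 1) (by lia) rfl, ← hs]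
    have e := factors_iff_comp_π.1 (hb (p + 1 + 1) (q + 1) (by lia)).2
    simp [DecoratedComplex.conn, Units.smul_def, e]

/-- Each component is null-homotopic. Composing the homotopies with the projections from `E` and the
inclusions into `F` gives a cochain `b` in `decM` of degree `k - 1`, and subtracting `δ b` from `γ`
leaves an element of `decM`. -/
lemma mem_decNull_of_stCochain_eq_zero (h : stCochain γ hγ = 0) :
    γ ∈ decNull K E.toDecoratedComplex F.toDecoratedComplex k := by
  have h0 : ∀ p q hpq, (strictOfCochain γ hγ p q hpq).hom = 0 := fun p q hpq => by
    rw [← stCochain_v, h, Cochain.zero_v]; rfl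
  choose s hs1 hs2 using fun p q hpq => (StrictHom.hom_eq_zero_iff _).1 (h0 p q hpq)
  -- From `p + (k - 1) = q` follows `p + k = q + 1`, so the homotopy in position `(p, q + 1)` starts
  -- at `Eᵖ⁺¹ / Mᵖ⁺¹` and ends in the decoration of `F` in degree `q + 1`.
  obtain ⟨b, hb⟩ := exists_cochain (X := E.cx) (Y := F.cx) (k := k - 1)
    (fun p q hpq x => x = cokernel.π (E.M (p + 1)).arrow ≫ s p (q + 1) (by omega) ≫
      (F.M (q + 1)).arrow) (fun p q hpq => ⟨_, rfl⟩)
  have hbM : b ∈ decM K E.toDecoratedComplex F.toDecoratedComplex (k - 1) := by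
    intro p q hpq
    obtain ⟨p, rfl⟩ : ∃ n, p = n + 1 := ⟨p - 1, by omega⟩
    obtain ⟨q, rfl⟩ : ∃ n, q = n + 1 := ⟨q - 1, by omega⟩
    rw [hb p q (by omega), cokernel.condition_assoc, zero_comp, ← Category.assoc]
    exact ⟨rfl, Subobject.factors_comp_arrow _⟩
  refine mem_decNull.2 ⟨γ - δ (k - 1) k b, ?_, b, hbM, (sub_add_cancel _ _).symm⟩
  intro p q hpq
  -- `hb` describes `b` only in positions `(p + 1, q + 1)`. The coboundary in position `(p + 1, q +
  -- 2)` uses `b` in positions `(p + 1, q + 1)` and `(p + 2, q + 2)`, both of this form.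
  obtain ⟨p, rfl⟩ : ∃ n, p = n + 1 := ⟨p - 1, by omega⟩
  obtain ⟨q, rfl⟩ : ∃ n, q = n + 1 + 1 := ⟨q - 1 - 1, by omega⟩
  rw [factors_iff_comp_π, Cochain.sub_v, δ_v (k - 1) k (by omega) b (p + 1) (q + 1 + 1) hpq
    (q + 1) (p + 1 + 1) (by omega) rfl, hb p q (by omega), hb (p + 1) (q + 1) (by omega)]
  -- Two neighbouring homotopies control one component: the `-1` equation in position `p + 1` gives
  -- vanishing on the decoration, the `0` equation in position `p` gives the image in the
  -- decoration.
  have e1 := hs1 (p + 1) (q + 1 + 1) hpq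
  have e2 := hs2 p (q + 1) (by omega)
  have e3 := strictOfCochain_neg_arrow γ hγ (p + 1) (q + 1 + 1) hpq
  have e4 := π_strictOfCochain_zer γ hγ p (q + 1) (by omega)
  rw [e1] at e3
  rw [e2] at e4
  simp only [DecoratedComplex.conn, Category.assoc, Units.smul_def] at e3 e4
  constructor
  · simp [e3, Units.smul_def, smul_smul, ← Units.val_mul]
  · simp [← e4, Units.smul_def]

end

/-- Fillings of the squares between links, one for each position, form a cochain. They may be chosen
independently: two fillings of the same square differ by a map that kills the decoration and lands
in the decoration, hence by a component of an element of `decM`. -/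
lemma exists_stCochain_eq {h : Cochain E.toStCx.cx F.toStCx.cx k} (H : IsStCochain h) :
    ∃ γ hγ, stCochain (K := K) (E := E) (F := F) γ hγ = h := by
  obtain ⟨f, hf, hfill⟩ := H
  -- The terms of `E.toStCx` are `E.term p` by definition; the retyping exposes the subobjects and
  -- cokernels.
  let f' : ∀ p q : ℤ, p + k = q → StrictHom (E.term p) (F.term q) := f
  obtain ⟨γ, hγ⟩ := exists_cochain (X := E.cx) (Y := F.cx) (k := k)
    (fun p q hpq x =>
      (E.M (p + 1)).arrow ≫ x = (k.negOnePow • (f' (p + 1) (q + 1) (by lia)).neg) ≫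
        (F.M (q + 1)).arrow ∧
      x ≫ cokernel.π (F.M (q + 1)).arrow = cokernel.π (E.M (p + 1)).arrow ≫ (f' p q hpq).zer)
    (fun p q hpq => hfill p (p + 1) q (q + 1) hpq (by lia) rfl (E.link p) (F.link q)
      (E.toStCx_d p).symm (F.toStCx_d q).symm)
  have hγ1 : ∀ p q hpq, (E.M p).arrow ≫ γ.v p q hpq =
      k.negOnePow • (f' p q hpq).neg ≫ (F.M q).arrow := by
    intro p q hpq
    obtain ⟨p, rfl⟩ : ∃ n, p = n + 1 := ⟨p - 1, by lia⟩
    obtain ⟨q, rfl⟩ : ∃ n, q = n + 1 := ⟨q - 1, by lia⟩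
    simpa using (hγ p q (by lia)).1
  have hmem : γ ∈ decHom K E.toDecoratedComplex F.toDecoratedComplex k := by
    refine mem_decHom.2 ⟨fun p q hpq => ?_, fun p q hpq => ?_⟩
    · rw [hγ1, ← Linear.units_smul_comp]
      exact Subobject.factors_comp_arrow _
    -- Modulo the decoration of `F`, the restriction of `δ γ` to `Mᵖ` is `(-1)ᵏ` times the
    -- difference of the two sides of the commutative square of the strict morphism `f' p q`.
    · obtain ⟨q, rfl⟩ : ∃ n, q = n + 1 := ⟨q - 1, by lia⟩
      have e1 := hγ1 p q (by lia)
      have e2 := (hγ p q (by lia)).2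
      have e3 := (f' p q (by lia)).comm
      simp only [DecoratedComplex.conn, Category.assoc] at e3
      rw [factors_iff_comp_π, δ_v k (k + 1) rfl γ p (q + 1) hpq q (p + 1) (by lia) rfl]
      simp [reassoc_of% e1, e2, e3, Int.negOnePow_succ, Units.smul_def]
  refine ⟨γ, hmem, ?_⟩
  ext p q hpq
  rw [hf, stCochain_v]
  refine congrArg StrictHom.hom (strictHom_ext' (g := f' p q hpq) ?_ ?_)
  · rw [strictOfCochain_neg_arrow, hγ1, smul_smul, Int.units_mul_self, one_smul]
  · rw [π_strictOfCochain_zer, (hγ p q hpq).2]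

lemma stCochain_comp {H : DecCx τ} {l m : ℤ} (h : k + l = m) (γ : Cochain E.cx F.cx k)
    (hγ : γ ∈ decHom K E.toDecoratedComplex F.toDecoratedComplex k) (β : Cochain F.cx H.cx l)
    (hβ : β ∈ decHom K F.toDecoratedComplex H.toDecoratedComplex l) :
    stCochain (γ.comp β h) (decHom_comp h hγ hβ) = (stCochain γ hγ).comp (stCochain β hβ) h := by
  ext p r hpr
  rw [Cochain.comp_v _ _ h p (p + k) r rfl (by lia), stCochain_v,
    strictOfCochain_comp γ hγ p (p + k) rfl h β hβ r (by lia)]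
  exact StrictHom.hom_comp _ _

variable (K) in
lemma stCochain_ofHom (f : E ⟶ F) :
    stCochain (K := K) (Cochain.ofHom f.map) (ofHom_mem_decHom f) =
      Cochain.ofHom ((G τ).map f).map := by
  ext n
  rw [stCochain_v, strictOfCochain_ofHom]
  exact (Cochain.ofHom_v ((G τ).map f).map n).symm

end DecCx

/-! ### The DG functor and its action on Hom complexes -/

variable (K : Type w) [CommRing K] [Linear K A]

variable (τ) in
/-- The DG functor extending `G`. -/
noncomputable def dgG : DGFunctor K (G τ).obj where
  map {E F k} := Submodule.liftQ _ (DecCx.stCochainHom E F K k) fun γ hγ =>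
    Subtype.ext (DecCx.stCochain_eq_zero_of_mem γ.1 γ.2 hγ)
  map_d {E F k} x := by
    obtain ⟨γ, hγ, rfl⟩ := DecHomQuot.exists_mk x
    exact Subtype.ext (DecCx.δ_stCochain γ hγ).symm
  -- The identity is the class of a chain map, so this follows from agreement with `G` there and
  -- functoriality of `G`.
  map_id E := Subtype.ext ((DecCx.stCochain_ofHom K (𝟙 E)).trans
    (congrArg (fun f => Cochain.ofHom (StCx.Hom.map f)) ((G τ).map_id E)))
  map_comp {E F H m n p} h x y := by
    obtain ⟨γ, hγ, rfl⟩ := DecHomQuot.exists_mk x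
    obtain ⟨β, hβ, rfl⟩ := DecHomQuot.exists_mk y
    exact Subtype.ext (DecCx.stCochain_comp h γ hγ β hβ)

/-- Passing to the quotient by `decNull` divides out exactly the kernel of the passage to strict
cochains, which is surjective by the choice of fillings. -/
lemma dgG_map_bijective (E F : DecCx τ) (k : ℤ) :
    Function.Bijective ((dgG τ K).map (X := E) (Y := F) (n := k)) := by
  constructor
  · refine (injective_iff_map_eq_zero _).2 fun x hx => ?_
    obtain ⟨γ, hγ, rfl⟩ := DecHomQuot.exists_mk x
    exact DecHomQuot.mk_eq_zero.2
      (DecCx.mem_decNull_of_stCochain_eq_zero γ hγ (congrArg Subtype.val hx))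
  · rintro ⟨h, H⟩
    obtain ⟨γ, hγ, rfl⟩ := DecCx.exists_stCochain_eq (K := K) (E := E) (F := F) H
    exact ⟨DecHomQuot.mk K γ hγ, rfl⟩

/-! ### Isomorphisms of strict complexes from isomorphisms of butterflies -/

section

variable {X Y : StCx τ} (P : ∀ n, Butterfly (X.cx.X n) (X.cx.X (n + 1)))
  (Q : ∀ n, Butterfly (Y.cx.X n) (Y.cx.X (n + 1)))

/-- Strict morphisms that extend to compatible morphisms of the butterflies representing the
differentials form a closed morphism of degree zero. -/
lemma exists_closed_of_butterflies
    (hP : ∀ n, (P n).hom = X.cx.d n (n + 1)) (hQ : ∀ n, (Q n).hom = Y.cx.d n (n + 1))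
    (t : ∀ n, StrictHom (X.cx.X n) (Y.cx.X n))
    (g : ∀ n, (P n).E ⟶ (Q n).E)
    (hκ : ∀ n, (P n).κ ≫ g n = (t n).neg ≫ (Q n).κ)
    (hι : ∀ n, (P n).ι ≫ g n = (t (n + 1)).neg ≫ (Q n).ι)
    (hσ : ∀ n, g n ≫ (Q n).σ = (P n).σ ≫ (t n).zer)
    (hρ : ∀ n, g n ≫ (Q n).ρ = (P n).ρ ≫ (t (n + 1)).zer) :
    ∃ φ : X.cx ⟶ Y.cx, (∀ n, φ.f n = (t n).hom) ∧ IsStCochain (Cochain.ofHom φ) := by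
  let φ : X.cx ⟶ Y.cx :=
    { f := fun n => (t n).hom
      comm' := by
        rintro n _ rfl
        rw [← hP, ← hQ]
        exact Butterfly.square₀ _ _ _ _ (g n) (hι n) (hσ n) (hκ n) (hρ n) }
  refine ⟨φ, fun n => rfl, fun p q hpq => by obtain rfl : p = q := by lia
                                             exact t p, fun p q hpq => ?_, ?_⟩
  · obtain rfl : p = q := by lia
    exact Cochain.ofHom_v φ p
  · rintro p _ q q' hpq hpq' rfl E F hE hF
    obtain rfl : p = q := by lia
    obtain rfl : p + 1 = q' := by lia
    exact Fillable.of_rel ⟨g p, by simp [hι], hσ p⟩ ((hP p).trans hE.symm) ((hQ p).trans hF.symm)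

/-- The inverse isomorphisms satisfy the same four compatibilities, so both directions give closed
morphisms of degree zero. They are mutually inverse because the underlying strict morphisms are so
in each degree. -/
lemma dgIsomorphic_of_butterflies
    (hP : ∀ n, (P n).hom = X.cx.d n (n + 1)) (hQ : ∀ n, (Q n).hom = Y.cx.d n (n + 1))
    (K : Type w) [CommRing K] [Linear K A]
    (a : ∀ n, (X.cx.X n).neg ≅ (Y.cx.X n).neg) (b : ∀ n, (X.cx.X n).zer ≅ (Y.cx.X n).zer)
    (g : ∀ n, (P n).E ≅ (Q n).E)
    (hκ : ∀ n, (P n).κ ≫ (g n).hom = (a n).hom ≫ (Q n).κ)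
    (hι : ∀ n, (P n).ι ≫ (g n).hom = (a (n + 1)).hom ≫ (Q n).ι)
    (hσ : ∀ n, (g n).hom ≫ (Q n).σ = (P n).σ ≫ (b n).hom)
    (hρ : ∀ n, (g n).hom ≫ (Q n).ρ = (P n).ρ ≫ (b (n + 1)).hom) :
    DGIsomorphic K X Y := by
  have hκ' : ∀ n, (Q n).κ ≫ (g n).inv = (a n).inv ≫ (P n).κ := fun n => by
    rw [Iso.comp_inv_eq, Category.assoc, hκ, Iso.inv_hom_id_assoc]
  have hι' : ∀ n, (Q n).ι ≫ (g n).inv = (a (n + 1)).inv ≫ (P n).ι := fun n => by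
    rw [Iso.comp_inv_eq, Category.assoc, hι, Iso.inv_hom_id_assoc]
  have hσ' : ∀ n, (g n).inv ≫ (P n).σ = (Q n).σ ≫ (b n).inv := fun n => by
    rw [Iso.inv_comp_eq, ← Category.assoc, hσ, Category.assoc, Iso.hom_inv_id, Category.comp_id]
  have hρ' : ∀ n, (g n).inv ≫ (P n).ρ = (Q n).ρ ≫ (b (n + 1)).inv := fun n => by
    rw [Iso.inv_comp_eq, ← Category.assoc, hρ, Category.assoc, Iso.hom_inv_id, Category.comp_id]
  -- Commutation with the maps `X⁻¹ ⟶ X⁰` needs no hypothesis of its own: these maps are `κ ≫ σ`.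
  let t : ∀ n, StrictHom (X.cx.X n) (Y.cx.X n) := fun n => ⟨(a n).hom, (b n).hom, by
    rw [← (P n).κ_σ, Category.assoc, ← hσ, reassoc_of% hκ n, (Q n).κ_σ]⟩
  let s : ∀ n, StrictHom (Y.cx.X n) (X.cx.X n) := fun n => ⟨(a n).inv, (b n).inv, by
    rw [← (Q n).κ_σ, Category.assoc, ← hσ', reassoc_of% hκ' n, (P n).κ_σ]⟩
  obtain ⟨φ, hφ, Hφ⟩ := exists_closed_of_butterflies P Q hP hQ t (fun n => (g n).hom) hκ hι hσ hρ
  obtain ⟨ψ, hψ, Hψ⟩ :=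
    exists_closed_of_butterflies Q P hQ hP s (fun n => (g n).inv) hκ' hι' hσ' hρ'
  have h1 : φ ≫ ψ = 𝟙 _ := by
    ext n
    rw [HomologicalComplex.comp_f, hφ, hψ, ← StrictHom.hom_comp]
    refine (congrArg StrictHom.hom ?_).trans (StrictHom.hom_id _)
    ext <;> simp [t, s]
  have h2 : ψ ≫ φ = 𝟙 _ := by
    ext n
    rw [HomologicalComplex.comp_f, hφ, hψ, ← StrictHom.hom_comp]
    refine (congrArg StrictHom.hom ?_).trans (StrictHom.hom_id _)
    ext <;> simp [t, s]
  refine ⟨⟨Cochain.ofHom φ, Hφ⟩, ⟨Cochain.ofHom ψ, Hψ⟩, Subtype.ext (δ_ofHom φ),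
    Subtype.ext (δ_ofHom ψ), Subtype.ext ?_, Subtype.ext ?_⟩
  · exact (Cochain.ofHom_comp φ ψ).symm.trans (congrArg Cochain.ofHom h1)
  · exact (Cochain.ofHom_comp ψ φ).symm.trans (congrArg Cochain.ofHom h2)

end

/-! ### Reconstruction of a decorated complex from a complex in the tilt -/

/-- The two conditions factor `t` through a map from the cokernel of `X.d`, in `T`, to the kernel of
`Y.d`, in `F`. This is where the orthogonality of the torsion theory enters. -/
lemma Tilt.eq_zero_of_comp_d {X Y : Tilt τ} (t : X.zer ⟶ Y.neg) (h1 : X.d ≫ t = 0)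
    (h2 : t ≫ Y.d = 0) : t = 0 := by
  have h : cokernel.desc X.d t h1 ≫ Y.d = 0 := by
    rw [← cancel_epi (cokernel.π X.d), cokernel.π_desc_assoc, h2, comp_zero]
  have h0 : kernel.lift Y.d _ h = 0 := τ.hom_eq_zero X.coker_mem Y.ker_mem _
  rw [← cokernel.π_desc X.d t h1, ← kernel.lift_ι Y.d _ h, h0, zero_comp, comp_zero]

/-- Two consecutive links compose to zero, because there are no morphisms from the torsion objects
to the torsion-free ones. -/
lemma Butterfly.link_comp_link {X Y Z W : Tilt τ} {P : Butterfly X Y} {Q : Butterfly Y Z}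
    {R : Butterfly Z W} {d : P.E ⟶ Q.E} {d' : Q.E ⟶ R.E} (h1 : P.ι ≫ d = Q.κ)
    (h2 : P.κ ≫ d = 0) (h3 : Q.κ ≫ d' = 0) (h4 : d' ≫ R.σ = Q.ρ) (h5 : d ≫ Q.ρ = 0)
    (h6 : d' ≫ R.ρ = 0) : d ≫ d' = 0 := by
  -- The composite is killed by `R.σ`, so it lands in `W⁻¹`; it kills `P.ι`, so it factors through
  -- `X⁰`. The resulting map `t : X⁰ ⟶ W⁻¹` is killed by both differentials, since `d` kills `P.κ`
  -- and `R.ρ` kills `d'`.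
  obtain ⟨y, hy⟩ := R.lift_ι (d ≫ d') (by rw [Category.assoc, h4, h5])
  have hy0 : P.ι ≫ y = 0 := by
    rw [← cancel_mono R.ι, Category.assoc, hy, reassoc_of% h1, h3, zero_comp]
  obtain ⟨t, rfl⟩ : ∃ t, P.σ ≫ t = y :=
    ⟨P.shortExact.exact.desc y hy0, P.shortExact.exact.g_desc y hy0⟩
  have ht : t = 0 := by
    apply Tilt.eq_zero_of_comp_d
    · rw [← cancel_mono R.ι, ← P.κ_σ, zero_comp, Category.assoc, Category.assoc]
      rw [Category.assoc] at hy
      rw [hy, reassoc_of% h2, zero_comp]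
    · rw [← cancel_epi P.σ, ← R.ι_ρ, ← Category.assoc, ← Category.assoc, hy, Category.assoc, h6,
        comp_zero, comp_zero]
  rw [← hy, ht, comp_zero, zero_comp]

/-- The middle term of the `n`-th butterfly must sit in degree `n + 1` of the decorated complex. The
shift is a mere reindexing, with no sign on the differential. -/
lemma exists_complex_shift (C : CochainComplex A ℤ) :
    ∃ (E : CochainComplex A ℤ) (φ : ∀ n, E.X (n + 1) ≅ C.X n),
      ∀ n, E.d (n + 1) (n + 1 + 1) ≫ (φ (n + 1)).hom = (φ n).hom ≫ C.d n (n + 1) :=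
  ⟨{ X := fun m => C.X (m - 1)
     d := fun i j => C.d (i - 1) (j - 1)
     shape := fun i j h => C.shape _ _ fun h' => h (by
       simp only [ComplexShape.up_Rel] at h' ⊢; lia) },
    fun n => C.XIsoOfEq (by lia), fun n => by simp⟩

/-- By exactness `B.σ` is a cokernel of `B.ι`, and `i` is isomorphic to `B.ι` as an arrow. -/
lemma Butterfly.exists_cokernel_iso {X Y : Tilt τ} (B : Butterfly X Y) {M E : A} (i : M ⟶ E)
    (a : M ≅ Y.neg) (φ : E ≅ B.E) (h : i ≫ φ.hom = a.hom ≫ B.ι) :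
    ∃ b : cokernel i ≅ X.zer, cokernel.π i ≫ b.hom = φ.hom ≫ B.σ := by
  let e := (cokernelIsCokernel B.ι).coconePointUniqueUpToIso B.shortExact.gIsCokernel
  have he : cokernel.π B.ι ≫ e.hom = B.σ :=
    IsColimit.comp_coconePointUniqueUpToIso_hom (cokernelIsCokernel B.ι)
      B.shortExact.gIsCokernel WalkingParallelPair.one
  refine ⟨cokernel.mapIso i B.ι a φ h ≪≫ e, ?_⟩
  simp [he]

/-- A complex in the tilted category determines a decorated complex, whose terms are the middle
terms of the butterflies representing the differentials. -/
lemma exists_decoratedComplex (Y : CochainComplex (Tilt τ) ℤ)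
    (B : ∀ n, Butterfly (Y.X n) (Y.X (n + 1))) (hB : ∀ n, (B n).hom = Y.d n (n + 1)) :
    ∃ (E : DecoratedComplex A) (a : ∀ n, (E.M n : A) ≅ (Y.X n).neg)
      (b : ∀ n, cokernel (E.M (n + 1)).arrow ≅ (Y.X n).zer)
      (φ : ∀ n, E.cx.X (n + 1) ≅ (B n).E),
      (∀ n, (E.M n).arrow ≫ E.cx.d n (n + 1) ≫ (φ n).hom = (a n).hom ≫ (B n).κ) ∧
      (∀ n, (E.M (n + 1)).arrow ≫ (φ n).hom = (a (n + 1)).hom ≫ (B n).ι) ∧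
      (∀ n, (φ n).hom ≫ (B n).σ = cokernel.π (E.M (n + 1)).arrow ≫ (b n).hom) ∧
      (∀ n, (φ n).hom ≫ (B n).ρ =
        E.cx.d (n + 1) (n + 1 + 1) ≫ cokernel.π (E.M (n + 1 + 1)).arrow ≫ (b (n + 1)).hom) := by
  -- The links, which exist because consecutive differentials compose to zero, will be the
  -- differential of `E`.
  choose d hd1 hd2 hd3 hd4 using fun n => (comp_eq_zero_iff (B n) (B (n + 1))).1
    (by rw [hB, hB, HomologicalComplex.d_comp_d])
  obtain ⟨E, φ, hφ⟩ := exists_complex_shift (CochainComplex.of (fun n => (B n).E) d fun n =>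
    link_comp_link (hd1 n) (hd3 n) (hd3 (n + 1)) (hd2 (n + 1)) (hd4 n) (hd4 (n + 1)))
  replace hφ : ∀ n, E.d (n + 1) (n + 1 + 1) ≫ (φ (n + 1)).hom = (φ n).hom ≫ d n := fun n =>
    (hφ n).trans (congrArg _ (CochainComplex.of_d (fun n => (B n).E) d n))
  -- In degree `n + 1` the decoration is the image of `(B n).ι`. The subobject and its
  -- identification with the `-1` part of `Y` are chosen together, so that both become families over
  -- all degrees.
  obtain ⟨M, hM⟩ := exists_forall_succ
    (α := fun m => Σ M : Subobject (E.X m), ((M : A) ≅ (Y.X m).neg))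
    (fun n x => x.1.arrow ≫ (φ n).hom = x.2.hom ≫ (B n).ι)
    (fun n => ⟨⟨Subobject.mk ((B n).ι ≫ (φ n).inv), Subobject.underlyingIso _⟩, by
      rw [← Subobject.underlyingIso_hom_comp_eq_mk, Category.assoc, Category.assoc,
        Iso.inv_hom_id]
      exact congrArg _ (Category.comp_id _)⟩)
  choose b hb using fun n => (B n).exists_cokernel_iso _ _ _ (hM n)
  refine ⟨⟨E, fun m => (M m).1⟩, fun m => (M m).2, b, φ, fun n => ?_, hM, fun n => (hb n).symm,
    fun n => ?_⟩
  -- The decoration in degree `m + 1` comes from `(B m).ι`, and the link out of `B m` carries `(B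
  -- m).ι` to `(B (m + 1)).κ`.
  · obtain ⟨n, rfl⟩ : ∃ m, n = m + 1 := ⟨n - 1, by lia⟩
    have e := hM n =≫ d n
    simp only [Category.assoc, hd1] at e
    exact (congrArg _ (hφ n)).trans e
  · have e := congrArg (fun x => E.d (n + 1) (n + 1 + 1) ≫ x) (hb (n + 1))
    exact ((congrArg _ (hd2 n).symm).trans ((Category.assoc _ _ _).symm.trans
      (congrArg (· ≫ (B (n + 1)).σ) (hφ n).symm))).trans ((Category.assoc _ _ _).trans e.symm)

/-- The reconstructed decoration is compatible with the torsion theory because each connecting map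
`E.conn n` is isomorphic, as an arrow, to the `n`-th term of `Y`, and `T` and `F` are closed under
isomorphisms. The isomorphisms of the reconstruction then identify the links of `E` with the chosen
butterflies. -/
lemma exists_toStCx_dgIsomorphic (K : Type w) [CommRing K] [Linear K A] (Y : StCx τ) :
    ∃ E : DecCx τ, DGIsomorphic K E.toStCx Y := by
  choose B hB using fun n => exists_hom (Y.cx.d n (n + 1))
  obtain ⟨E, a, b, φ, hκ, hι, hσ, hρ⟩ := exists_decoratedComplex Y.cx B hB
  have hconn : ∀ n, E.conn n ≫ (b n).hom = (a n).hom ≫ (Y.cx.X n).d := fun n => by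
    rw [← (B n).κ_σ, ← reassoc_of% hκ n, hσ, DecoratedComplex.conn, Category.assoc, Category.assoc]
  let E' : DecCx τ :=
    { toDecoratedComplex := E
      compatible :=
        { ker_mem := fun n => τ.F_iso.of_iso
            (kernel.mapIso (E.conn n) (Y.cx.X n).d (a n) (b n) (hconn n)).symm (Y.cx.X n).ker_mem
          coker_mem := fun n => τ.T_iso.of_iso
            (cokernel.mapIso (E.conn n) (Y.cx.X n).d (a n) (b n) (hconn n)).symm
            (Y.cx.X n).coker_mem } }
  refine ⟨E', dgIsomorphic_of_butterflies (X := E'.toStCx) E'.link B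
    (fun n => (E'.toStCx_d n).symm) hB K a b φ (fun n => ?_) hι hσ (fun n => ?_)⟩
  · exact (Category.assoc _ _ _).trans (hκ n)
  · exact (hρ n).trans (Category.assoc _ _ _).symm

end HRS

/-- Let `A` be a `K`-linear abelian category with a torsion theory `τ = (T, F)`, and let
`G : Ch(A, T, F) ⥤ Ch^st(B)` be the functor that sends a decorated complex `(E, M)` to the complex
of the objects `[Mⁿ ⟶ Eⁿ⁺¹ / Mⁿ⁺¹]` whose differentials are the butterflies with middle terms
`Eⁿ⁺¹`. There is a DG functor `Φ` with the same action on objects as `G` such that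

* `Φ` sends the class of a cochain `γ = (gₙ)` of degree `k` to the sequence of strict morphisms
  `((-1)ᵏ gₙ, gₙ₊₁)`;
* `Φ` extends `G`, i.e. it agrees with `G` on chain maps;
* `Φ` is a DG equivalence, with isomorphisms on the complexes of morphisms. -/
theorem propositionP {K : Type*} [CommRing K] {A : Type*} [Category A] [Abelian A] [Linear K A]
    (τ : HRS.TorsionTheory A) :
    ∃ Φ : HRS.DGFunctor K (HRS.G τ).obj,
      (∀ (E F : HRS.DecCx τ) (k : ℤ) (γ : CochainComplex.HomComplex.Cochain E.cx F.cx k)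
        (hγ : γ ∈ HRS.decHom K E.toDecoratedComplex F.toDecoratedComplex k)
        (p q : ℤ) (hpq : p + k = q),
        (Φ.map (X := E) (Y := F) (n := k) (HRS.DecHomQuot.mk K γ hγ)).1.v p q hpq =
          (HRS.DecCx.strictOfCochain γ hγ p q hpq).hom) ∧
      (∀ (E F : HRS.DecCx τ) (f : E ⟶ F),
        (Φ.map (X := E) (Y := F) (n := 0)
          (HRS.DecHomQuot.mk K (CochainComplex.HomComplex.Cochain.ofHom f.map)
            (HRS.ofHom_mem_decHom f))).1 =
          CochainComplex.HomComplex.Cochain.ofHom ((HRS.G τ).map f).map) ∧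
      Φ.IsEquivalence := by
  refine ⟨HRS.dgG τ K, fun E F k γ hγ p q hpq => rfl, fun E F f => ?_, ?_, ?_⟩
  · exact HRS.DecCx.stCochain_ofHom K f
  · exact HRS.dgG_map_bijective K
  · exact HRS.exists_toStCx_dgIsomorphic K
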